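/- Let $d\in\mathbb N$, let $\mathbb F_d^*$ be the free semigroup with unit $\varnothing$ on $d$ generators, and let $L_u$ ($u\in\mathbb F_d^*$) be the isometries of $\ell^2(\mathbb F_d^*)$ given by $L_u\xi_w=\xi_{uw}$. The noncommutative analytic Toeplitz algebra $\mathcal L_d\subset B(\ell^2(\mathbb F_d^*))$ is the closure, in the weak operator topology (WOT), of the unital algebra generated by the $L_u$. Its comultiplication $\Delta$ is the unique weak*-continuous homomorphism from $\mathcal L_d$ into $B(\ell^2(\mathbb F_d^*)\otimes\ell^2(\mathbb F_d^*))$ with $\Delta(L_u)=L_u\otimes L_u$ for all $u$. Let $\mathcal J$ be a homogeneous Hopf ideal of $\mathcal L_d$, that is, a WOT-closed two-sided ideal which is generated, as such an ideal, by homogeneous polynomials in the generators of $\mathcal L_d$, and for which $\Delta(\mathcal J)$ is contained in the weak* closure of $\mathcal J\otimes\mathcal L_d+\mathcal L_d\otimes\mathcal J$. Put $$\mathcal N_{\mathcal J}=(\mathcal J\xi_\varnothing)^\perp,\qquad \pi_{\mathcal J}(A)=P_{\mathcal N_{\mathcal J}}A|_{\mathcal N_{\mathcal J}},\qquad \mathcal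 L_{\mathcal J}=\pi_{\mathcal J}(\mathcal L_d),$$ and let $\Delta_{\mathcal J}$ be the comultiplication of $\mathcal L_{\mathcal J}$ determined by $\Delta_{\mathcal J}\circ\pi_{\mathcal J}=(\pi_{\mathcal J}\otimes\pi_{\mathcal J})\circ\Delta$, where $\pi_{\mathcal J}\otimes\pi_{\mathcal J}$ denotes the compression to $\mathcal N_{\mathcal J}\otimes\mathcal N_{\mathcal J}$. The standard predual $(\mathcal L_{\mathcal J})_*$ (the trace class operators on $\mathcal N_{\mathcal J}$ modulo the preannihilator of $\mathcal L_{\mathcal J}$, with the quotient norm) is a commutative Banach algebra under $\varphi\star\psi=(\varphi\otimes\psi)\circ\Delta_{\mathcal J}$. Let $\mathbb F_d^{*0}$ be $\mathbb F_d^*$ with a zero adjoined, put $L_0=0$, and let $S=\mathbb F_d^{*0}/{\sim}$ be the semigroup associated with $\mathcal J$, where $u\sim v$ if and only if $L_u-L_v\in\mathcal J$. For $s\in S$ let $L_s=\pi_{\mathcal J}(L_w)\in\mathcal L_{\mathcal J}$, where $w$ is any representative of $s$. Let $S_0$ be the set of nonzero elements of $S$. Then: 1. The Gelfand spectrum of $(\mathcal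 L_{\mathcal J})_*$ is $S_0$: the map $s\mapsto\rho_s$, $\rho_s(\varphi)=\varphi(L_s)$, is a bijection from $S_0$ onto the set of nonzero multiplicative continuous linear functionals on $(\mathcal L_{\mathcal J})_*$. 2. The semigroup-like elements of $\mathcal L_{\mathcal J}$ are exactly the $L_s$: for $F\in\mathcal L_{\mathcal J}$ one has $\Delta_{\mathcal J}(F)=F\otimes F$ if and only if $F=L_s$ for some $s\in S$, and this $s$ is then unique. -/

import Mathlib

open scoped InnerProductSpace ENNReal

noncomputable section

namespace NCToeplitz

section Predual

variable {E : Type*} [NormedAddCommGroup E] [InnerProductSpace ℂ E]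
variable (A : Submodule ℂ (E →L[ℂ] E))

/-- The functional `φ` on `A` is `T ↦ Tr (C T)`, where `C = ∑ₙ xₙ yₙ*` is a trace class operator
given by a nuclear representation. -/
def IsTraceRep {A : Submodule ℂ (E →L[ℂ] E)} (φ : A →ₗ[ℂ] ℂ) (x y : ℕ → E) : Prop :=
  Summable (fun n => ‖x n‖ * ‖y n‖) ∧ ∀ T : A, φ T = ∑' n, ⟪y n, (T : E →L[ℂ] E) (x n)⟫_ℂ

theorem norm_inner_apply_le (T : E →L[ℂ] E) (x y : E) : ‖⟪y, T x⟫_ℂ‖ ≤ ‖T‖ * (‖x‖ * ‖y‖) := by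
  calc ‖⟪y, T x⟫_ℂ‖ ≤ ‖y‖ * ‖T x‖ := norm_inner_le_norm _ _
    _ ≤ ‖y‖ * (‖T‖ * ‖x‖) := by gcongr; exact T.le_opNorm x
    _ = _ := by ring

theorem summable_inner_apply {ι : Type*} {x y : ι → E} (h : Summable (fun n => ‖x n‖ * ‖y n‖))
    (T : E →L[ℂ] E) : Summable (fun n => ⟪y n, T (x n)⟫_ℂ) :=
  Summable.of_norm_bounded (h.mul_left ‖T‖) fun _ => norm_inner_apply_le _ _ _

/-- Representations indexed by a countable set can be re-indexed by `ℕ`. -/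
theorem exists_traceRep {A : Submodule ℂ (E →L[ℂ] E)} {ι : Type*} [Countable ι] {x y : ι → E}
    {φ : A →ₗ[ℂ] ℂ} (h : Summable (fun n => ‖x n‖ * ‖y n‖))
    (hφ : ∀ T : A, φ T = ∑' n, ⟪y n, (T : E →L[ℂ] E) (x n)⟫_ℂ) :
    ∃ x' y' : ℕ → E, IsTraceRep φ x' y' ∧ ∑' n, ‖x' n‖ * ‖y' n‖ = ∑' n, ‖x n‖ * ‖y n‖ := by
  obtain ⟨e, he⟩ := exists_injective_nat ι
  have key : ∀ {F : Type} [NormedAddCommGroup F] (g : E → E → F), g 0 0 = 0 →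
      (fun n => g (Function.extend e x 0 n) (Function.extend e y 0 n)) =
        Function.extend e (fun i => g (x i) (y i)) 0 := by
    intro F _ g hg
    funext n
    by_cases hn : ∃ i, e i = n
    · obtain ⟨i, rfl⟩ := hn
      simp [he.extend_apply]
    · simp [Function.extend_apply' _ _ _ hn, hg]
  have k1 := key (fun a b => ‖a‖ * ‖b‖) (by simp)
  refine ⟨Function.extend e x 0, Function.extend e y 0, ⟨?_, fun T => ?_⟩, ?_⟩
  · rw [k1]
    exact (summable_extend_zero he).2 h
  · have k2 := key (fun a b => ⟪b, (T : E →L[ℂ] E) a⟫_ℂ) (by simp)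
    rw [k2, hφ, ← ((hasSum_extend_zero he).2 (summable_inner_apply h _).hasSum).tsum_eq]
  · rw [k1]
    exact ((hasSum_extend_zero he).2 h.hasSum).tsum_eq

theorem exists_traceRep_add {A : Submodule ℂ (E →L[ℂ] E)} {φ ψ : A →ₗ[ℂ] ℂ} {x y x' y' : ℕ → E}
    (h : IsTraceRep φ x y) (h' : IsTraceRep ψ x' y') :
    ∃ x₁ y₁ : ℕ → E, IsTraceRep (φ + ψ) x₁ y₁ ∧
      ∑' n, ‖x₁ n‖ * ‖y₁ n‖ = ∑' n, ‖x n‖ * ‖y n‖ + ∑' n, ‖x' n‖ * ‖y' n‖ := by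
  have hs : HasSum (fun i => ‖Sum.elim x x' i‖ * ‖Sum.elim y y' i‖)
      (∑' n, ‖x n‖ * ‖y n‖ + ∑' n, ‖x' n‖ * ‖y' n‖) :=
    HasSum.sum (f := fun i => ‖Sum.elim x x' i‖ * ‖Sum.elim y y' i‖) h.1.hasSum h'.1.hasSum
  rw [← hs.tsum_eq]
  refine exists_traceRep hs.summable fun T => ?_
  have := HasSum.sum (f := fun i => ⟪Sum.elim y y' i, (T : E →L[ℂ] E) (Sum.elim x x' i)⟫_ℂ)
    (summable_inner_apply h.1 T).hasSum (summable_inner_apply h'.1 T).hasSum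
  rw [this.tsum_eq, LinearMap.add_apply, h.2, h'.2]

/-- The standard predual `A_* = S₁(E) / A_⊥`: since the trace class operators are the nuclear
ones, its elements are the functionals `T ↦ ∑ₙ ⟨T xₙ, yₙ⟩` on `A` with `∑ₙ ‖xₙ‖ ‖yₙ‖ < ∞`. -/
def Predual : Submodule ℂ (A →ₗ[ℂ] ℂ) where
  carrier := {φ | ∃ x y : ℕ → E, IsTraceRep φ x y}
  zero_mem' := ⟨0, 0, by simp [IsTraceRep]⟩
  add_mem' := by
    rintro φ ψ ⟨x, y, h⟩ ⟨x', y', h'⟩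
    obtain ⟨x₁, y₁, h₁, -⟩ := exists_traceRep_add h h'
    exact ⟨x₁, y₁, h₁⟩
  smul_mem' := by
    rintro c φ ⟨x, y, h⟩
    refine ⟨fun n => c • x n, y, ?_, fun T => ?_⟩
    · simpa [norm_smul, mul_assoc] using h.1.mul_left ‖c‖
    · simp [h.2, tsum_mul_left]

variable {A}

/-- The trace (nuclear) norm modulo `A_⊥`. -/
instance : Norm (Predual A) where
  norm φ := sInf {c | ∃ x y : ℕ → E, IsTraceRep φ.1 x y ∧ c = ∑' n, ‖x n‖ * ‖y n‖}

theorem Predual.norm_le {ι : Type*} [Countable ι] {x y : ι → E} (φ : Predual A)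
    (h : Summable (fun n => ‖x n‖ * ‖y n‖))
    (hφ : ∀ T : A, φ.1 T = ∑' n, ⟪y n, (T : E →L[ℂ] E) (x n)⟫_ℂ) :
    ‖φ‖ ≤ ∑' n, ‖x n‖ * ‖y n‖ := by
  obtain ⟨x', y', h', e⟩ := exists_traceRep h hφ
  rw [← e]
  refine csInf_le ⟨0, ?_⟩ ⟨x', y', h', rfl⟩
  rintro _ ⟨x, y, -, rfl⟩
  positivity

theorem Predual.exists_rep_lt (φ : Predual A) {ε : ℝ} (hε : 0 < ε) :
    ∃ x y : ℕ → E, IsTraceRep φ.1 x y ∧ ∑' n, ‖x n‖ * ‖y n‖ < ‖φ‖ + ε := by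
  have hne : {c | ∃ x y : ℕ → E, IsTraceRep φ.1 x y ∧ c = ∑' n, ‖x n‖ * ‖y n‖}.Nonempty := by
    obtain ⟨x, y, h⟩ := φ.2
    exact ⟨_, x, y, h, rfl⟩
  obtain ⟨_, ⟨x, y, h, rfl⟩, hlt⟩ := exists_lt_of_csInf_lt hne (lt_add_of_pos_right _ hε)
  exact ⟨x, y, h, hlt⟩

theorem Predual.norm_nonneg' (φ : Predual A) : 0 ≤ ‖φ‖ := by
  refine Real.sInf_nonneg ?_
  rintro _ ⟨x, y, -, rfl⟩
  positivity

theorem Predual.norm_apply_le (φ : Predual A) (T : A) : ‖φ.1 T‖ ≤ ‖φ‖ * ‖(T : E →L[ℂ] E)‖ := by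
  refine le_of_forall_pos_le_add fun δ hδ => ?_
  obtain ⟨x, y, h, hlt⟩ := Predual.exists_rep_lt φ
    (ε := δ / (‖(T : E →L[ℂ] E)‖ + 1)) (by positivity)
  have h1 : ‖φ.1 T‖ ≤ ‖(T : E →L[ℂ] E)‖ * ∑' n, ‖x n‖ * ‖y n‖ := by
    rw [h.2, ← tsum_mul_left]
    exact tsum_of_norm_bounded (h.1.mul_left _).hasSum fun _ => norm_inner_apply_le _ _ _
  have h2 : ‖(T : E →L[ℂ] E)‖ * (δ / (‖(T : E →L[ℂ] E)‖ + 1)) ≤ δ := by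
    rw [mul_div_assoc', div_le_iff₀ (by positivity)]
    nlinarith [norm_nonneg (T : E →L[ℂ] E)]
  nlinarith [norm_nonneg (T : E →L[ℂ] E),
    mul_le_mul_of_nonneg_left hlt.le (norm_nonneg (T : E →L[ℂ] E))]

theorem Predual.norm_smul_le' (c : ℂ) (φ : Predual A) : ‖c • φ‖ ≤ ‖c‖ * ‖φ‖ := by
  refine le_of_forall_pos_le_add fun δ hδ => ?_
  obtain ⟨x, y, h, hlt⟩ := Predual.exists_rep_lt φ (ε := δ / (‖c‖ + 1)) (by positivity)
  have h1 : ‖c • φ‖ ≤ ∑' n, ‖c • x n‖ * ‖y n‖ := by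
    refine Predual.norm_le (c • φ) ?_ fun T => ?_
    · simpa [norm_smul, mul_assoc] using h.1.mul_left ‖c‖
    · simp [h.2, tsum_mul_left]
  simp only [norm_smul, mul_assoc, tsum_mul_left] at h1
  have h2 : ‖c‖ * (δ / (‖c‖ + 1)) ≤ δ := by
    rw [mul_div_assoc', div_le_iff₀ (by positivity)]
    nlinarith [norm_nonneg c]
  nlinarith [norm_nonneg c, mul_le_mul_of_nonneg_left hlt.le (norm_nonneg c)]

theorem Predual.core : NormedSpace.Core ℂ (Predual A) where
  norm_nonneg := Predual.norm_nonneg'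
  norm_smul c φ := by
    refine le_antisymm (Predual.norm_smul_le' c φ) ?_
    by_cases hc : c = 0
    · simpa [hc] using Predual.norm_nonneg' ((0 : ℂ) • φ)
    · have := Predual.norm_smul_le' c⁻¹ (c • φ)
      rw [smul_smul, inv_mul_cancel₀ hc, one_smul, norm_inv] at this
      have hc' : 0 < ‖c‖ := norm_pos_iff.2 hc
      rwa [inv_mul_eq_div, le_div_iff₀' hc'] at this
  norm_triangle φ ψ := by
    refine le_of_forall_pos_le_add fun δ hδ => ?_
    obtain ⟨x, y, h, hlt⟩ := Predual.exists_rep_lt φ (ε := δ / 2) (by positivity)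
    obtain ⟨x', y', h', hlt'⟩ := Predual.exists_rep_lt ψ (ε := δ / 2) (by positivity)
    obtain ⟨x₁, y₁, h₁, e⟩ := exists_traceRep_add h h'
    have := Predual.norm_le (φ + ψ) h₁.1 h₁.2
    linarith
  norm_eq_zero_iff φ := by
    constructor
    · intro h
      ext T
      simpa [h] using Predual.norm_apply_le φ T
    · rintro rfl
      refine le_antisymm ?_ (Predual.norm_nonneg' _)
      simpa using Predual.norm_le (A := A) (ι := ℕ) (x := 0) (y := 0) 0 (by simp) (by simp)

instance : NormedAddCommGroup (Predual A) := NormedAddCommGroup.ofCore Predual.core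
instance : NormedSpace ℂ (Predual A) := NormedSpace.ofCore Predual.core

/-- Absolutely convergent series of elements of the predual. -/
theorem Predual.exists_series (w : ℕ → Predual A) (x y : ℕ → ℕ → E) (c : ℕ → ℝ)
    (hw : ∀ k, IsTraceRep (w k).1 (x k) (y k)) (hc : ∀ k, ∑' n, ‖x k n‖ * ‖y k n‖ ≤ c k)
    (hsum : Summable c) (f : A →ₗ[ℂ] ℂ) (hf : ∀ T, f T = ∑' k, (w k).1 T) :
    ∃ h : f ∈ Predual A, ‖(⟨f, h⟩ : Predual A)‖ ≤ ∑' k, c k := by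
  have h1 : Summable fun p : ℕ × ℕ => ‖x p.1 p.2‖ * ‖y p.1 p.2‖ := by
    rw [summable_prod_of_nonneg fun p => by positivity]
    refine ⟨fun k => (hw k).1, Summable.of_nonneg_of_le (fun k => ?_) hc hsum⟩
    exact tsum_nonneg fun n => by positivity
  have h2 : ∀ T : A, f T = ∑' p : ℕ × ℕ, ⟪y p.1 p.2, (T : E →L[ℂ] E) (x p.1 p.2)⟫_ℂ := by
    intro T
    rw [(summable_inner_apply h1 T).tsum_prod, hf]
    exact tsum_congr fun k => (hw k).2 T
  have h3 : f ∈ Predual A := by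
    obtain ⟨x', y', h', -⟩ := exists_traceRep h1 h2
    exact ⟨x', y', h'⟩
  refine ⟨h3, (Predual.norm_le ⟨f, h3⟩ h1 h2).trans ?_⟩
  rw [h1.tsum_prod]
  exact h1.prod.tsum_le_tsum hc hsum

instance : CompleteSpace (Predual A) := by
  refine NormedAddCommGroup.completeSpace_of_summable_imp_tendsto fun u hu => ?_
  choose x y hr hlt using fun k => Predual.exists_rep_lt (u k) (ε := (1 / 2 : ℝ) ^ k) (by positivity)
  have hc : Summable fun k => ‖u k‖ + (1 / 2 : ℝ) ^ k := hu.add summable_geometric_two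
  have hsT : ∀ T : A, Summable fun k => (u k).1 T := fun T =>
    Summable.of_norm_bounded (hu.mul_right ‖(T : E →L[ℂ] E)‖) fun k => Predual.norm_apply_le (u k) T
  let f : A →ₗ[ℂ] ℂ :=
    { toFun := fun T => ∑' k, (u k).1 T
      map_add' := fun S T => by simp [(hsT S).tsum_add (hsT T)]
      map_smul' := fun c T => by simp [tsum_mul_left] }
  obtain ⟨hf, -⟩ := Predual.exists_series u x y _ hr (fun k => (hlt k).le) hc f fun T => rfl
  refine ⟨⟨f, hf⟩, ?_⟩
  rw [tendsto_iff_norm_sub_tendsto_zero]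
  refine squeeze_zero (fun n => norm_nonneg _) (fun n => ?_)
    (tendsto_sum_nat_add fun k => ‖u k‖ + (1 / 2 : ℝ) ^ k)
  rw [norm_sub_rev]
  obtain ⟨h, hle⟩ := Predual.exists_series (fun k => u (k + n)) _ _ _ (fun k => hr (k + n))
    (fun k => (hlt (k + n)).le) ((summable_nat_add_iff n).2 hc)
    ((⟨f, hf⟩ : Predual A) - ∑ i ∈ Finset.range n, u i : Predual A).1 (fun T => by
      have := (hsT T).sum_add_tsum_nat_add n
      simp only [Submodule.coe_sub, LinearMap.sub_apply, Submodule.coe_sum, LinearMap.sum_apply]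
      rw [sub_eq_iff_eq_add']
      exact this.symm)
  exact hle

end Predual

section SquareSummable

/-- The Hilbert space `ℓ²(ι)`. -/
def Ell2 (ι : Type*) : Type _ := lp (fun _ : ι => ℂ) 2

variable {ι I K X : Type*}

instance : NormedAddCommGroup (Ell2 ι) :=
  inferInstanceAs (NormedAddCommGroup (lp (fun _ : ι => ℂ) 2))
instance : InnerProductSpace ℂ (Ell2 ι) :=
  inferInstanceAs (InnerProductSpace ℂ (lp (fun _ : ι => ℂ) 2))
instance : CompleteSpace (Ell2 ι) := inferInstanceAs (CompleteSpace (lp (fun _ : ι => ℂ) 2))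
instance : FunLike (Ell2 ι) ι ℂ where
  coe f := f.1
  coe_injective _ _ h := Subtype.ext h

@[ext]
theorem Ell2.ext {f g : Ell2 ι} (h : ∀ i, f i = g i) : f = g := DFunLike.ext _ _ h

@[simp]
theorem Ell2.add_apply (f g : Ell2 ι) (i : ι) : (f + g) i = f i + g i := rfl

@[simp]
theorem Ell2.smul_apply (c : ℂ) (f : Ell2 ι) (i : ι) : (c • f) i = c * f i := rfl

@[simp]
theorem Ell2.zero_apply (i : ι) : (0 : Ell2 ι) i = 0 := rfl

theorem two_toReal_pos : 0 < (2 : ℝ≥0∞).toReal := by norm_num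

theorem Ell2.hasSum_sq (f : Ell2 ι) : HasSum (fun i => ‖f i‖ ^ 2) (‖f‖ ^ 2) := by
  have h := lp.hasSum_norm (E := fun _ : ι => ℂ) two_toReal_pos f
  simp only [ENNReal.toReal_ofNat, Real.rpow_two] at h
  exact h

theorem Ell2.hasSum_inner (f g : Ell2 ι) : HasSum (fun i => ⟪f i, g i⟫_ℂ) ⟪f, g⟫_ℂ :=
  lp.hasSum_inner (𝕜 := ℂ) (G := fun _ : ι => ℂ) f g

/-- A square summable function as an element of `ℓ²`. -/
def Ell2.mk (f : ι → ℂ) (h : Summable fun i => ‖f i‖ ^ 2) : Ell2 ι :=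
  (⟨f, memℓp_gen (by simpa using h)⟩ : lp (fun _ : ι => ℂ) 2)

@[simp]
theorem Ell2.mk_apply (f : ι → ℂ) (h : Summable fun i => ‖f i‖ ^ 2) (i : ι) :
    Ell2.mk f h i = f i := rfl

theorem Ell2.norm_le {f : Ell2 ι} {C : ℝ} (hC : 0 ≤ C) (h : ∑' i, ‖f i‖ ^ 2 ≤ C ^ 2) :
    ‖f‖ ≤ C := by
  rw [f.hasSum_sq.tsum_eq] at h
  exact (sq_le_sq₀ (norm_nonneg _) hC).1 h

/-- The basis vector `ξ_i`. -/
def ket (i : ι) : Ell2 ι := by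
  classical exact lp.single (E := fun _ : ι => ℂ) 2 i 1

theorem ket_self (i : ι) : ket i i = 1 := by
  classical exact lp.single_apply_self (E := fun _ : ι => ℂ) 2 i 1

theorem ket_ne {i j : ι} (h : j ≠ i) : ket i j = 0 := by
  classical exact lp.single_apply_ne (E := fun _ : ι => ℂ) 2 i 1 h

theorem inner_ket (i : ι) (f : Ell2 ι) : ⟪ket i, f⟫_ℂ = f i := by
  classical
  have h : ⟪ket i, f⟫_ℂ = ⟪(1 : ℂ), f i⟫_ℂ :=
    lp.inner_single_left (𝕜 := ℂ) (G := fun _ : ι => ℂ) i 1 f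
  simpa using h

theorem hasSum_ket (f : Ell2 ι) : HasSum (fun i => f i • ket i) f := by
  classical
  have h : HasSum (fun i => (lp.single (E := fun _ : ι => ℂ) 2 i (f i) : Ell2 ι)) f :=
    lp.hasSum_single (E := fun _ : ι => ℂ) (p := 2) (by norm_num) f
  have h1 : (fun i => (lp.single (E := fun _ : ι => ℂ) 2 i (f i) : Ell2 ι)) =
      fun i => f i • ket i := by
    funext i
    refine Ell2.ext fun j => ?_
    rw [Ell2.smul_apply]
    by_cases hj : j = i
    · subst hj
      rw [ket_self, mul_one]
      exact lp.single_apply_self (E := fun _ : ι => ℂ) 2 j _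
    · rw [ket_ne hj, mul_zero]
      exact lp.single_apply_ne (E := fun _ : ι => ℂ) 2 i _ hj
  rwa [h1] at h

theorem Ell2.mem_of_ket {V : Submodule ℂ (Ell2 ι)} (hV : IsClosed (V : Set (Ell2 ι)))
    (h : ∀ i, ket i ∈ V) (f : Ell2 ι) : f ∈ V :=
  hV.mem_of_tendsto (hasSum_ket f)
    (Filter.Eventually.of_forall fun _ => V.sum_mem fun i _ => V.smul_mem _ (h i))

theorem norm_sq_extend {g : I → X} (hg : Function.Injective g) (f : I → ℂ) :
    (fun x => ‖Function.extend g f 0 x‖ ^ 2) = Function.extend g (fun i => ‖f i‖ ^ 2) 0 := by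
  funext x
  by_cases hx : ∃ i, g i = x
  · obtain ⟨i, rfl⟩ := hx
    simp [hg.extend_apply]
  · simp [Function.extend_apply' _ _ _ hx]

/-- The isometry `ℓ²(I) → ℓ²(X)`, `ξ_i ↦ ξ_{g i}`, given by an injective map `g`. -/
def shift (g : I → X) (hg : Function.Injective g) : Ell2 I →ₗᵢ[ℂ] Ell2 X where
  toFun f := Ell2.mk (Function.extend g f 0) (by
    rw [norm_sq_extend hg]
    exact (summable_extend_zero hg).2 f.hasSum_sq.summable)
  map_add' f f' := by
    ext x
    by_cases hx : ∃ i, g i = x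
    · obtain ⟨i, rfl⟩ := hx
      simp [hg.extend_apply]
    · simp [Function.extend_apply' _ _ _ hx]
  map_smul' c f := by
    ext x
    by_cases hx : ∃ i, g i = x
    · obtain ⟨i, rfl⟩ := hx
      simp [hg.extend_apply]
    · simp [Function.extend_apply' _ _ _ hx]
  norm_map' f := by
    have h1 : ∀ F : Ell2 X, (∀ x, F x = Function.extend g f 0 x) → ‖F‖ = ‖f‖ := by
      intro F hF
      have h3 := F.hasSum_sq
      simp only [hF] at h3
      rw [norm_sq_extend hg, hasSum_extend_zero hg] at h3
      exact (sq_eq_sq₀ (norm_nonneg _) (norm_nonneg _)).1 (h3.unique f.hasSum_sq)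
    exact h1 _ fun x => rfl

theorem shift_apply {g : I → X} (hg : Function.Injective g) (f : Ell2 I) (i : I) :
    shift g hg f (g i) = f i := hg.extend_apply _ _ _

theorem shift_apply' {g : I → X} (hg : Function.Injective g) (f : Ell2 I) {x : X}
    (hx : ¬∃ i, g i = x) : shift g hg f x = 0 := by
  change Function.extend g f 0 x = 0
  simp [Function.extend_apply' _ _ _ hx]

theorem shift_ket {g : I → X} (hg : Function.Injective g) (i : I) :
    shift g hg (ket i) = ket (g i) := by
  ext x
  by_cases hx : ∃ j, g j = x
  · obtain ⟨j, rfl⟩ := hx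
    rw [shift_apply]
    by_cases h : j = i
    · rw [h, ket_self, ket_self]
    · rw [ket_ne h, ket_ne (hg.ne h)]
  · rw [shift_apply' hg _ hx, ket_ne]
    rintro rfl
    exact hx ⟨i, rfl⟩

/-- The `k`-th column `i ↦ f (e (i, k))` of `f ∈ ℓ²(X)`, where `e : I × K ≃ X`. -/
def slice (e : I × K ≃ X) (k : K) : Ell2 X →ₗ[ℂ] Ell2 I where
  toFun f := Ell2.mk (fun i => f (e (i, k)))
    (f.hasSum_sq.summable.comp_injective (e.injective.comp (Prod.mk_left_injective k)))
  map_add' f f' := rfl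
  map_smul' c f := by ext i; simp

theorem slice_apply (e : I × K ≃ X) (k : K) (f : Ell2 X) (i : I) :
    slice e k f i = f (e (i, k)) := rfl

theorem summable_slice (e : I × K ≃ X) (f : Ell2 X) :
    Summable fun p : K × I => ‖f (e (p.2, p.1))‖ ^ 2 :=
  f.hasSum_sq.summable.comp_injective (e.injective.comp Prod.swap_injective)

theorem hasSum_norm_slice (e : I × K ≃ X) (f : Ell2 X) :
    HasSum (fun k => ‖slice e k f‖ ^ 2) (‖f‖ ^ 2) := by
  have h := (((Equiv.prodComm K I).trans e).hasSum_iff).2 f.hasSum_sq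
  exact h.prod_fiberwise fun k => (slice e k f).hasSum_sq

/-- The operator `T ⊗ 1` on `ℓ²(I) ⊗ ℓ²(K) = ℓ²(I × K) ≅ ℓ²(X)`, i.e. `T` is applied to every
column of a vector. -/
def ampliation (e : I × K ≃ X) (T : Ell2 I →L[ℂ] Ell2 I) : Ell2 X →L[ℂ] Ell2 X :=
  LinearMap.mkContinuous
    { toFun := fun f => Ell2.mk (fun x => T (slice e (e.symm x).2 f) (e.symm x).1) (by
        rw [← ((Equiv.prodComm K I).trans e).summable_iff,
          summable_prod_of_nonneg fun p => by simp only [Function.comp]; positivity]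
        refine ⟨fun k => ?_, ?_⟩
        · simpa using (T (slice e k f)).hasSum_sq.summable
        · simp only [Function.comp, Equiv.trans_apply, Equiv.prodComm_apply, Prod.swap_prod_mk,
            Equiv.symm_apply_apply]
          simp only [(T (slice e _ f)).hasSum_sq.tsum_eq]
          refine Summable.of_nonneg_of_le (fun k => by positivity) (fun k => ?_)
            ((hasSum_norm_slice e f).summable.mul_left (‖T‖ ^ 2))
          rw [← mul_pow]
          gcongr
          exact T.le_opNorm _)
      map_add' := fun f f' => by ext x; simp
      map_smul' := fun c f => by ext x; simp }
    ‖T‖ (fun f => by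
      have key : ∀ F : Ell2 X, (∀ k, slice e k F = T (slice e k f)) → ‖F‖ ≤ ‖T‖ * ‖f‖ := by
        intro F hF
        refine (sq_le_sq₀ (norm_nonneg _) (by positivity)).1 ?_
        rw [mul_pow]
        refine hasSum_le (fun k => ?_) (hasSum_norm_slice e F)
          ((hasSum_norm_slice e f).mul_left (‖T‖ ^ 2))
        rw [hF, ← mul_pow]
        gcongr
        exact T.le_opNorm _
      refine key _ fun k => ?_
      ext i
      simp [slice_apply])

theorem ampliation_apply (e : I × K ≃ X) (T : Ell2 I →L[ℂ] Ell2 I) (f : Ell2 X) (i : I) (k : K) :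
    ampliation e T f (e (i, k)) = T (slice e k f) i := by
  simp [ampliation]

theorem slice_ampliation (e : I × K ≃ X) (T : Ell2 I →L[ℂ] Ell2 I) (f : Ell2 X) (k : K) :
    slice e k (ampliation e T f) = T (slice e k f) := by
  ext i
  rw [slice_apply, ampliation_apply]

theorem hasSum_inner_slice (e : I × K ≃ X) (f g : Ell2 X) :
    HasSum (fun k => ⟪slice e k g, slice e k f⟫_ℂ) ⟪g, f⟫_ℂ := by
  have h := (((Equiv.prodComm K I).trans e).hasSum_iff).2 (g.hasSum_inner f)
  exact h.prod_fiberwise fun k => (slice e k g).hasSum_inner (slice e k f)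

theorem hasSum_inner_ampliation (e : I × K ≃ X) (T : Ell2 I →L[ℂ] Ell2 I) (f g : Ell2 X) :
    HasSum (fun k => ⟪slice e k g, T (slice e k f)⟫_ℂ) ⟪g, ampliation e T f⟫_ℂ := by
  simpa only [slice_ampliation] using hasSum_inner_slice e (ampliation e T f) g

theorem summable_norm_slice_mul (e : I × K ≃ X) (f g : Ell2 X) :
    Summable (fun k => ‖slice e k f‖ * ‖slice e k g‖) ∧
      ∑' k, ‖slice e k f‖ * ‖slice e k g‖ ≤ ‖f‖ * ‖g‖ := by
  have hf : Summable fun k => ‖slice e k f‖ ^ (2 : ℝ) := by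
    simpa using (hasSum_norm_slice e f).summable
  have hg : Summable fun k => ‖slice e k g‖ ^ (2 : ℝ) := by
    simpa using (hasSum_norm_slice e g).summable
  refine ⟨Real.summable_mul_of_Lp_Lq_of_nonneg Real.HolderConjugate.two_two
    (fun _ => norm_nonneg _) (fun _ => norm_nonneg _) hf hg,
    (Real.inner_le_Lp_mul_Lq_tsum_of_nonneg Real.HolderConjugate.two_two
    (fun _ => norm_nonneg _) (fun _ => norm_nonneg _) hf hg).trans (le_of_eq ?_)⟩
  have h1 := (hasSum_norm_slice e f).tsum_eq
  have h2 := (hasSum_norm_slice e g).tsum_eq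
  simp only [Real.rpow_two, h1, h2, ← Real.sqrt_eq_rpow]
  rw [Real.sqrt_sq (norm_nonneg _), Real.sqrt_sq (norm_nonneg _)]

/-- The elementary tensor `x ⊗ y`, under the identification `ℓ²(I) ⊗ ℓ²(K) = ℓ²(I × K)`. -/
def tmul : Ell2 I →L[ℂ] Ell2 K →L[ℂ] Ell2 (I × K) :=
  LinearMap.mkContinuous₂
    (LinearMap.mk₂ ℂ (fun x y => Ell2.mk (fun p : I × K => x p.1 * y p.2) (by
        simpa only [norm_mul, mul_pow] using x.hasSum_sq.summable.mul_of_nonneg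
          y.hasSum_sq.summable (fun _ => by positivity) (fun _ => by positivity)))
      (fun x x' y => by ext p; simp [add_mul])
      (fun c x y => by ext p; simp [mul_assoc])
      (fun x y y' => by ext p; simp [mul_add])
      (fun c x y => by ext p; simp [mul_left_comm]))
    1 (fun x y => by
      refine Ell2.norm_le (by positivity) (le_of_eq ?_)
      rw [one_mul, mul_pow, ← x.hasSum_sq.tsum_eq, ← y.hasSum_sq.tsum_eq,
        x.hasSum_sq.summable.tsum_mul_tsum y.hasSum_sq.summable
          (x.hasSum_sq.summable.mul_of_nonneg y.hasSum_sq.summable (fun _ => by positivity)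
            fun _ => by positivity)]
      simp [mul_pow])

theorem tmul_apply (x : Ell2 I) (y : Ell2 K) (p : I × K) : tmul x y p = x p.1 * y p.2 := rfl

end SquareSummable

section Words

/-- The free semigroup with unit on `d` generators. -/
abbrev Word (d : ℕ) : Type := FreeMonoid (Fin d)

/-- The Fock space `ℓ²(𝔽_d^*)`. -/
abbrev Fock (d : ℕ) : Type := Ell2 (Word d)

/-- The Hilbert space tensor square `ℓ²(𝔽_d^*) ⊗ ℓ²(𝔽_d^*) = ℓ²(𝔽_d^* × 𝔽_d^*)`. -/
abbrev Fock2 (d : ℕ) : Type := Ell2 (Word d × Word d)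

variable {d : ℕ}

instance : Countable (Word d) := inferInstanceAs (Countable (List (Fin d)))

/-- Pairs of words without a common first letter. -/
def CoprimePair (d : ℕ) : Type :=
  {m : Word d × Word d // ∀ (i : Fin d) (u v : Word d),
    ¬(m.1 = FreeMonoid.of i * u ∧ m.2 = FreeMonoid.of i * v)}

instance : Countable (CoprimePair d) := inferInstanceAs (Countable (Subtype _))

/-- Exchange of the two words. -/
def CoprimePair.swap : CoprimePair d ≃ CoprimePair d where
  toFun m := ⟨m.1.swap, fun i u v h => m.2 i v u ⟨h.2, h.1⟩⟩
  invFun m := ⟨m.1.swap, fun i u v h => m.2 i v u ⟨h.2, h.1⟩⟩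
  left_inv _ := rfl
  right_inv _ := rfl

theorem of_mul_inj {i j : Fin d} {u v : Word d}
    (h : FreeMonoid.of i * u = FreeMonoid.of j * v) : i = j ∧ u = v := by
  have h' : (i :: FreeMonoid.toList u : List (Fin d)) = j :: FreeMonoid.toList v := h
  simpa using h'

theorem prefix_bijective :
    Function.Bijective fun p : Word d × CoprimePair d => (p.1 * p.2.1.1, p.1 * p.2.1.2) := by
  constructor
  · rintro ⟨p, m⟩ ⟨q, n⟩ h
    simp only [Prod.mk.injEq] at h
    obtain ⟨h1, h2⟩ := h
    have hpq : p = q := by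
      induction p using FreeMonoid.inductionOn' generalizing q with
      | one =>
        induction q using FreeMonoid.inductionOn' with
        | one => rfl
        | of_mul j q _ =>
          exact (m.2 j (q * n.1.1) (q * n.1.2) ⟨by simpa [mul_assoc] using h1,
            by simpa [mul_assoc] using h2⟩).elim
      | of_mul i p ih =>
        induction q using FreeMonoid.inductionOn' with
        | one =>
          exact (n.2 i (p * m.1.1) (p * m.1.2) ⟨by simpa [mul_assoc] using h1.symm,
            by simpa [mul_assoc] using h2.symm⟩).elim
        | of_mul j q _ =>
          rw [mul_assoc, mul_assoc] at h1 h2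
          obtain ⟨rfl, h3⟩ := of_mul_inj h1
          rw [ih q h3 (of_mul_inj h2).2]
    subst hpq
    have e1 := mul_left_cancel h1
    have e2 := mul_left_cancel h2
    exact Prod.ext rfl (Subtype.ext (Prod.ext e1 e2))
  · rintro ⟨u, v⟩
    induction u using FreeMonoid.inductionOn' generalizing v with
    | one =>
      refine ⟨(1, ⟨(1, v), ?_⟩), by simp⟩
      rintro i u' v' ⟨h, -⟩
      have h' : ([] : List (Fin d)) = i :: FreeMonoid.toList u' := h
      simp at h'
    | of_mul i u ih =>
      by_cases hv : ∃ v', v = FreeMonoid.of i * v'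
      · obtain ⟨v', rfl⟩ := hv
        obtain ⟨⟨p, m⟩, hp⟩ := ih v'
        simp only [Prod.mk.injEq] at hp
        exact ⟨(FreeMonoid.of i * p, m), by simp [mul_assoc, hp.1, hp.2]⟩
      · refine ⟨(1, ⟨(FreeMonoid.of i * u, v), ?_⟩), by simp⟩
        rintro j u' v' ⟨h, h'⟩
        obtain ⟨rfl, -⟩ := of_mul_inj h
        exact hv ⟨v', h'⟩

/-- Splitting off the longest common prefix of a pair of words: `(p, (a, b)) ↦ (p a, p b)`. -/
def prefixEquiv (d : ℕ) : Word d × CoprimePair d ≃ Word d × Word d :=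
  Equiv.ofBijective _ prefix_bijective

theorem prefixEquiv_apply (p : Word d) (m : CoprimePair d) :
    prefixEquiv d (p, m) = (p * m.1.1, p * m.1.2) := rfl

/-- The operator `L_u`, `L_u ξ_w = ξ_{uw}`. -/
def leftShift (u : Word d) : Fock d →L[ℂ] Fock d :=
  (shift (fun w => u * w) (mul_right_injective u)).toContinuousLinearMap

theorem leftShift_ket (u w : Word d) : leftShift u (ket w) = ket (u * w) :=
  shift_ket (mul_right_injective u) w

theorem clm_ext_ket {ι : Type*} {F : Type*} [NormedAddCommGroup F] [NormedSpace ℂ F]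
    {S T : Ell2 ι →L[ℂ] F} (h : ∀ i, S (ket i) = T (ket i)) : S = T := by
  refine ContinuousLinearMap.ext fun f => ?_
  have := Ell2.mem_of_ket (V := LinearMap.ker ((S - T : Ell2 ι →L[ℂ] F) : Ell2 ι →ₗ[ℂ] F))
    (ContinuousLinearMap.isClosed_ker (S - T)) (fun i => by simp [h]) f
  simpa [sub_eq_zero] using this

/-- The left regular representation of `𝔽_d^*`. -/
def leftRegular (d : ℕ) : Word d →* (Fock d →L[ℂ] Fock d) where
  toFun := leftShift
  map_one' := clm_ext_ket fun w => by simp [leftShift_ket]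
  map_mul' u v := clm_ext_ket fun w => by simp [leftShift_ket, mul_assoc]

/-- The left regular representation of `𝔽_d^*` with a zero adjoined, with `L_0 = 0`. -/
def leftRegular₀ (d : ℕ) : WithZero (Word d) →*₀ (Fock d →L[ℂ] Fock d) :=
  WithZero.lift' (leftRegular d)

/-- The operator `C ⊗ D`. -/
def tensorOp (C D : Fock d →L[ℂ] Fock d) : Fock2 d →L[ℂ] Fock2 d :=
  ampliation (Equiv.refl _) C ∘L ampliation (Equiv.prodComm _ _) D

theorem tensorOp_tmul (C D : Fock d →L[ℂ] Fock d) (x y : Fock d) :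
    tensorOp C D (tmul x y) = tmul (C x) (D y) := by
  have h2 : ampliation (Equiv.prodComm (Word d) (Word d)) D (tmul x y) = tmul x (D y) := by
    ext ⟨u, v⟩
    have hs : slice (Equiv.prodComm (Word d) (Word d)) u (tmul x y) = x u • y := by
      ext v
      simp [slice_apply, tmul_apply]
    exact (ampliation_apply (Equiv.prodComm (Word d) (Word d)) D (tmul x y) v u).trans
      (by rw [hs]; simp [tmul_apply])
  have h1 : ampliation (Equiv.refl (Word d × Word d)) C (tmul x (D y)) = tmul (C x) (D y) := by
    ext ⟨u, v⟩
    have hs : slice (Equiv.refl (Word d × Word d)) v (tmul x (D y)) = D y v • x := by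
      ext u
      simp [slice_apply, tmul_apply, mul_comm]
    exact (ampliation_apply (Equiv.refl (Word d × Word d)) C (tmul x (D y)) u v).trans
      (by rw [hs]; simp [tmul_apply, mul_comm])
  rw [tensorOp, ContinuousLinearMap.comp_apply, h2, h1]

/-- The comultiplication `Δ`. The diagonal left action of `𝔽_d^*` on `𝔽_d^* × 𝔽_d^*` is free, the
orbits being `{(pa, pb) : p}` for `(a, b)` without a common first letter, so that
`L_w ↦ L_w ⊗ L_w` is an ampliation of the left regular representation, and `Δ` is this
ampliation. It is given by the same formula on all bounded operators. -/
def comul (T : Fock d →L[ℂ] Fock d) : Fock2 d →L[ℂ] Fock2 d :=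
  ampliation (prefixEquiv d) T

theorem ket_prod (u v : Word d) : ket (u, v) = tmul (ket u) (ket v) := by
  ext ⟨u', v'⟩
  rw [tmul_apply]
  by_cases h1 : u' = u
  · by_cases h2 : v' = v
    · simp [h1, h2, ket_self]
    · rw [ket_ne (by simp [h2]), ket_ne h2, mul_zero]
  · rw [ket_ne (by simp [h1]), ket_ne h1, zero_mul]

theorem slice_ket {I K X : Type*} (e : I × K ≃ X) (i : I) (k : K) :
    slice e k (ket (e (i, k))) = ket i := by
  ext j
  rw [slice_apply]
  by_cases h : j = i
  · rw [h, ket_self, ket_self]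
  · rw [ket_ne h, ket_ne (by simp [h])]

theorem slice_ket_ne {I K X : Type*} (e : I × K ≃ X) (i : I) {k k' : K} (h : k' ≠ k) :
    slice e k' (ket (e (i, k))) = 0 := by
  ext j
  rw [slice_apply, ket_ne (by simp [h])]
  rfl

theorem inner_ampliation_ket {I K X : Type*} (e : I × K ≃ X) (T : Ell2 I →L[ℂ] Ell2 I)
    (i : I) (k : K) (g : Ell2 X) :
    ⟪g, ampliation e T (ket (e (i, k)))⟫_ℂ = ⟪slice e k g, T (ket i)⟫_ℂ := by
  rw [← (hasSum_inner_ampliation e T _ g).tsum_eq, tsum_eq_single k]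
  · rw [slice_ket]
  · intro k' hk
    rw [slice_ket_ne e i hk]
    simp

/-- `Δ(L_w) = L_w ⊗ L_w`. -/
theorem comul_leftShift (w : Word d) :
    comul (leftShift w) = tensorOp (leftShift w) (leftShift w) := by
  refine clm_ext_ket fun x => ?_
  obtain ⟨⟨p, m⟩, rfl⟩ := (prefixEquiv d).surjective x
  have h1 : tensorOp (leftShift w) (leftShift w) (ket (prefixEquiv d (p, m))) =
      ket (prefixEquiv d (w * p, m)) := by
    rw [prefixEquiv_apply, ket_prod, tensorOp_tmul, leftShift_ket, leftShift_ket, ← ket_prod,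
      prefixEquiv_apply, mul_assoc, mul_assoc]
  rw [h1]
  refine ext_inner_left ℂ fun g => ?_
  rw [comul, inner_ampliation_ket, leftShift_ket, ← inner_conj_symm, inner_ket,
    ← inner_conj_symm, inner_ket, slice_apply]

end Words

section Toeplitz

variable {d : ℕ}

/-- The noncommutative analytic Toeplitz algebra `𝓛_d`: the closure, in the weak operator topology,
of the unital algebra generated by the left regular representation of `𝔽_d^*`. -/
def toeplitz (d : ℕ) : Subalgebra ℂ (Fock d →L[ℂ] Fock d) :=
  ((Algebra.adjoin ℂ (Set.range (leftShift (d := d)))).map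
    (ContinuousLinearMapWOT.algEquiv (E := Fock d) (𝕜₁ := ℂ) ℂ).symm.toAlgHom).topologicalClosure.comap
    (ContinuousLinearMapWOT.algEquiv (E := Fock d) (𝕜₁ := ℂ) ℂ).symm.toAlgHom

theorem mem_toeplitz_iff {T : Fock d →L[ℂ] Fock d} : T ∈ toeplitz d ↔
    ContinuousLinearMapWOT.ofCLM T ∈ closure (ContinuousLinearMapWOT.ofCLM ''
      (Algebra.adjoin ℂ (Set.range (leftShift (d := d))) : Set (Fock d →L[ℂ] Fock d))) :=
  Iff.rfl

theorem leftShift_mem (w : Word d) : leftShift w ∈ toeplitz d :=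
  mem_toeplitz_iff.2 (subset_closure ⟨_, Algebra.subset_adjoin ⟨w, rfl⟩, rfl⟩)

theorem leftRegular₀_mem (w : WithZero (Word d)) : leftRegular₀ d w ∈ toeplitz d := by
  induction w using WithZero.recZeroCoe with
  | zero => rw [map_zero]; exact zero_mem _
  | coe w => exact leftShift_mem w

theorem isClosed_toeplitz : IsClosed (toeplitz d : Set (Fock d →L[ℂ] Fock d)) :=
  (isClosed_closure (X := Fock d →WOT[ℂ] Fock d)).preimage ContinuousLinearMapWOT.continuous_ofCLM

theorem toeplitz_induction (f : (Fock d →L[ℂ] Fock d) →ₗ[ℂ] ℂ)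
    (hf : Continuous fun T : Fock d →WOT[ℂ] Fock d => f T.toCLM)
    (h : ∀ w, f (leftShift w) = 0) {T : Fock d →L[ℂ] Fock d} (hT : T ∈ toeplitz d) : f T = 0 := by
  have hle : Subalgebra.toSubmodule (Algebra.adjoin ℂ (Set.range (leftShift (d := d)))) ≤
      LinearMap.ker f := by
    rw [Algebra.adjoin_eq_span, Submodule.span_le]
    intro S hS
    have : Submonoid.closure (Set.range (leftShift (d := d))) ≤ MonoidHom.mrange (leftRegular d) :=
      Submonoid.closure_le.2 (by rintro _ ⟨w, rfl⟩; exact ⟨w, rfl⟩)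
    obtain ⟨w, rfl⟩ := this hS
    exact h w
  have hcl : IsClosed {T : Fock d →WOT[ℂ] Fock d | f T.toCLM = 0} :=
    isClosed_eq hf continuous_const
  refine closure_minimal ?_ hcl (mem_toeplitz_iff.1 hT)
  rintro _ ⟨S, hS, rfl⟩
  exact hle hS

/-- The ultraweak (weak*) topology on `B(E)`, i.e. the topology of pointwise convergence on the
predual of `B(E)`. -/
@[reducible]
def ultraweak (E : Type*) [NormedAddCommGroup E] [InnerProductSpace ℂ E] :
    TopologicalSpace (E →L[ℂ] E) :=
  TopologicalSpace.induced
    (fun T (φ : Predual (⊤ : Submodule ℂ (E →L[ℂ] E))) => φ.1 ⟨T, trivial⟩) Pi.topologicalSpace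

/-- Two-sided ideals of `𝓛_d` that are closed in the weak operator topology. -/
structure ToeplitzIdeal (d : ℕ) where
  /-- The underlying subspace. -/
  carrier : Submodule ℂ (Fock d →L[ℂ] Fock d)
  le_toeplitz : ∀ A ∈ carrier, A ∈ toeplitz d
  mul_mem_left : ∀ T ∈ toeplitz d, ∀ A ∈ carrier, T * A ∈ carrier
  mul_mem_right : ∀ T ∈ toeplitz d, ∀ A ∈ carrier, A * T ∈ carrier
  isClosed : IsClosed (X := Fock d →WOT[ℂ] Fock d)
    (ContinuousLinearMapWOT.ofCLM '' (carrier : Set (Fock d →L[ℂ] Fock d)))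

/-- An ideal is homogeneous if it is generated, as a closed ideal, by homogeneous polynomials in
the generators of `𝓛_d`. -/
def ToeplitzIdeal.IsHomogeneous (J : ToeplitzIdeal d) : Prop :=
  ∃ P : Set (Fock d →L[ℂ] Fock d),
    (∀ A ∈ P, ∃ n : ℕ, A ∈ Submodule.span ℂ (leftShift '' {w : Word d | w.length = n})) ∧
    P ⊆ J.carrier ∧ ∀ I : ToeplitzIdeal d, P ⊆ I.carrier → J.carrier ≤ I.carrier

/-- A Hopf ideal is an ideal that is also a coideal:
`Δ(J)` is contained in the weak* closure of `J ⊗ 𝓛_d + 𝓛_d ⊗ J`. -/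
structure HopfIdeal (d : ℕ) extends ToeplitzIdeal d where
  coideal : ∀ A ∈ carrier, comul A ∈ @closure _ (ultraweak (Fock2 d))
    (Submodule.span ℂ {T : Fock2 d →L[ℂ] Fock2 d | ∃ C D : Fock d →L[ℂ] Fock d,
      (C ∈ carrier ∧ D ∈ toeplitz d ∨ C ∈ toeplitz d ∧ D ∈ carrier) ∧ T = tensorOp C D})

end Toeplitz

section Compression

variable {E : Type*} [NormedAddCommGroup E] [InnerProductSpace ℂ E]
  (K : Submodule ℂ E) [K.HasOrthogonalProjection]

/-- The compression `P_K T|_K`. -/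
def compress : (E →L[ℂ] E) →ₗ[ℂ] (K →L[ℂ] K) where
  toFun T := K.orthogonalProjectionOnto ∘L T ∘L K.subtypeL
  map_add' S T := by ext x; simp
  map_smul' c T := by ext x; simp

/-- The extension of an operator on `K` by zero on the orthogonal complement of `K`. -/
def extendByZero : (K →L[ℂ] K) →ₗ[ℂ] (E →L[ℂ] E) where
  toFun B := K.subtypeL ∘L B ∘L K.orthogonalProjectionOnto
  map_add' S T := by ext x; simp
  map_smul' c T := by ext x; simp

theorem inner_compress (T : E →L[ℂ] E) (x y : K) :
    ⟪y, compress K T x⟫_ℂ = ⟪(y : E), T x⟫_ℂ := by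
  simp [compress]

theorem inner_extendByZero (B : K →L[ℂ] K) {x y : E} (hx : x ∈ K) (hy : y ∈ K) :
    ⟪y, extendByZero K B x⟫_ℂ = ⟪(⟨y, hy⟩ : K), B ⟨x, hx⟩⟫_ℂ := by
  have : K.orthogonalProjectionOnto x = ⟨x, hx⟩ :=
    K.orthogonalProjectionOnto_mem_subspace_eq_self ⟨x, hx⟩
  simp [extendByZero, this]

end Compression

namespace HopfIdeal

variable {d : ℕ} (J : HopfIdeal d)

/-- The space `N_J = (J ξ_∅)^⊥`. -/
def space : Submodule ℂ (Fock d) :=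
  (J.carrier.map (ContinuousLinearMap.apply ℂ (Fock d) (ket (1 : Word d)) :
    (Fock d →L[ℂ] Fock d) →ₗ[ℂ] Fock d))ᗮ

instance : CompleteSpace J.space := inferInstanceAs (CompleteSpace (_ᗮ : Submodule ℂ (Fock d)))

/-- The Hilbert space tensor product `N_J ⊗ N_J`, as a subspace of `ℓ²(𝔽_d^* × 𝔽_d^*)`. -/
def space2 : Submodule ℂ (Fock2 d) :=
  (Submodule.span ℂ {z | ∃ x ∈ J.space, ∃ y ∈ J.space, z = tmul x y}).topologicalClosure

instance : CompleteSpace J.space2 := inferInstanceAs (CompleteSpace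
  (Submodule.topologicalClosure (_ : Submodule ℂ (Fock2 d))))

/-- The compression map `π_J(A) = P_{N_J} A|_{N_J}`. -/
def proj : (Fock d →L[ℂ] Fock d) →ₗ[ℂ] (J.space →L[ℂ] J.space) := compress J.space

/-- The algebra `𝓛_J = P_{N_J} 𝓛_d|_{N_J}`. -/
def algebra : Submodule ℂ (J.space →L[ℂ] J.space) :=
  (Subalgebra.toSubmodule (toeplitz d)).map J.proj

/-- The comultiplication of `𝓛_J`, determined by `Δ_J(π_J(A)) = (π_J ⊗ π_J)(Δ(A))`, see
`comulJ_proj`; here `π_J ⊗ π_J` is the compression to `N_J ⊗ N_J`. -/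
def comulJ (B : J.space →L[ℂ] J.space) : J.space2 →L[ℂ] J.space2 :=
  compress J.space2 (comul (extendByZero J.space B))

/-- The operator `B ⊗ C` on `N_J ⊗ N_J`. -/
def tensorJ (B C : J.space →L[ℂ] J.space) : J.space2 →L[ℂ] J.space2 :=
  compress J.space2 (tensorOp (extendByZero J.space B) (extendByZero J.space C))

theorem mem_space_iff {x : Fock d} : x ∈ J.space ↔ ∀ A ∈ J.carrier, ⟪x, A (ket 1)⟫_ℂ = 0 := by
  rw [space, Submodule.mem_orthogonal']
  constructor
  · exact fun h A hA => h _ ⟨A, hA, rfl⟩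
  · rintro h _ ⟨A, hA, rfl⟩
    exact h A hA

theorem inner_space_ket {x : Fock d} (hx : x ∈ J.space) {A : Fock d →L[ℂ] Fock d}
    (hA : A ∈ J.carrier) (w : Word d) : ⟪x, A (ket w)⟫_ℂ = 0 := by
  have := (J.mem_space_iff.1 hx) _ (J.mul_mem_right _ (leftShift_mem w) A hA)
  simpa [leftShift_ket] using this

theorem inner_space {x : Fock d} (hx : x ∈ J.space) {A : Fock d →L[ℂ] Fock d}
    (hA : A ∈ J.carrier) (f : Fock d) : ⟪x, A f⟫_ℂ = 0 := by
  have := Ell2.mem_of_ket (V := LinearMap.ker ((innerSL ℂ x ∘L A : Fock d →L[ℂ] ℂ) :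
    Fock d →ₗ[ℂ] ℂ)) (ContinuousLinearMap.isClosed_ker (innerSL ℂ x ∘L A))
    (fun w => by simpa using J.inner_space_ket hx hA w) f
  simpa using this

theorem proj_eq_zero {A : Fock d →L[ℂ] Fock d} (hA : A ∈ J.carrier) : J.proj A = 0 := by
  ext1 x
  refine ext_inner_left ℂ fun y => ?_
  rw [proj, inner_compress, J.inner_space y.2 hA]
  simp

theorem tmul_mem {x y : Fock d} (hx : x ∈ J.space) (hy : y ∈ J.space) : tmul x y ∈ J.space2 :=
  Submodule.le_topologicalClosure _ (Submodule.subset_span ⟨x, hx, y, hy, rfl⟩)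

theorem space2_induction {V : Submodule ℂ (Fock2 d)} (hV : IsClosed (V : Set (Fock2 d)))
    (h : ∀ x ∈ J.space, ∀ y ∈ J.space, tmul x y ∈ V) {z : Fock2 d} (hz : z ∈ J.space2) : z ∈ V := by
  refine Submodule.topologicalClosure_minimal _ (Submodule.span_le.2 ?_) hV hz
  rintro _ ⟨x, hx, y, hy, rfl⟩
  exact h x hx y hy

theorem continuous_ultraweak_inner {E : Type*} [NormedAddCommGroup E] [InnerProductSpace ℂ E]
    (x y : E) : @Continuous _ _ (ultraweak E) _ fun T : E →L[ℂ] E => ⟪y, T x⟫_ℂ := by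
  let φ : (⊤ : Submodule ℂ (E →L[ℂ] E)) →ₗ[ℂ] ℂ :=
    { toFun := fun T => ⟪y, (T : E →L[ℂ] E) x⟫_ℂ
      map_add' := fun S T => by simp
      map_smul' := fun c T => by simp }
  obtain ⟨x', y', h, -⟩ := exists_traceRep (ι := Unit) (x := fun _ => x) (y := fun _ => y) (φ := φ)
    (Summable.of_finite) (fun T => by simp [φ])
  have h0 : @Continuous _ _ (ultraweak E) _
      fun T (φ : Predual (⊤ : Submodule ℂ (E →L[ℂ] E))) => φ.1 ⟨T, trivial⟩ :=
    continuous_induced_dom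
  let ψ : Predual (⊤ : Submodule ℂ (E →L[ℂ] E)) := ⟨φ, x', y', h⟩
  have h1 : Continuous fun g : Predual (⊤ : Submodule ℂ (E →L[ℂ] E)) → ℂ => g ψ :=
    continuous_apply ψ
  have h2 := @Continuous.comp _ _ _ (ultraweak E) _ _ _ _ h1 h0
  exact h2

end HopfIdeal

section SliceMaps

variable {d : ℕ}

theorem inner_tmul (x x' y y' : Fock d) :
    ⟪tmul x y, tmul x' y'⟫_ℂ = ⟪x, x'⟫_ℂ * ⟪y, y'⟫_ℂ := by
  have h1 : ∀ p : Word d × Word d, ⟪tmul x y p, tmul x' y' p⟫_ℂ =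
      ⟪x p.1, x' p.1⟫_ℂ * ⟪y p.2, y' p.2⟫_ℂ := by
    intro p
    simp only [tmul_apply, RCLike.inner_apply, map_mul]
    ring
  have h := (tmul x y).hasSum_inner (tmul x' y')
  simp only [h1] at h
  rw [← h.tsum_eq, ← (x.hasSum_inner x').tsum_eq, ← (y.hasSum_inner y').tsum_eq]
  exact ((x.hasSum_inner x').summable.tsum_mul_tsum (y.hasSum_inner y').summable h.summable).symm

theorem norm_tmul (x y : Fock d) : ‖tmul x y‖ = ‖x‖ * ‖y‖ := by
  have h : (‖tmul x y‖ : ℂ) ^ 2 = ((‖x‖ * ‖y‖ : ℝ) : ℂ) ^ 2 := by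
    have h1 := inner_self_eq_norm_sq_to_K (𝕜 := ℂ) (tmul x y)
    have h2 := inner_self_eq_norm_sq_to_K (𝕜 := ℂ) x
    have h3 := inner_self_eq_norm_sq_to_K (𝕜 := ℂ) y
    rw [inner_tmul, h2, h3] at h1
    push_cast
    rw [mul_pow]
    exact h1.symm
  exact (sq_eq_sq₀ (norm_nonneg _) (by positivity)).1 (by exact_mod_cast h)

theorem comul_add (S T : Fock d →L[ℂ] Fock d) : comul (S + T) = comul S + comul T := by
  ext f x
  obtain ⟨⟨p, m⟩, rfl⟩ := (prefixEquiv d).surjective x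
  simp [comul, ampliation_apply]

theorem comul_smul (c : ℂ) (T : Fock d →L[ℂ] Fock d) : comul (c • T) = c • comul T := by
  ext f x
  obtain ⟨⟨p, m⟩, rfl⟩ := (prefixEquiv d).surjective x
  simp [comul, ampliation_apply]

theorem norm_ampliation_le {I K X : Type*} (e : I × K ≃ X) (T : Ell2 I →L[ℂ] Ell2 I) :
    ‖ampliation e T‖ ≤ ‖T‖ := LinearMap.mkContinuous_norm_le _ (norm_nonneg _) _

theorem slice_tmul_swap (x y : Fock d) (m : CoprimePair d) :
    slice (prefixEquiv d) (CoprimePair.swap m) (tmul x y) = slice (prefixEquiv d) m (tmul y x) := by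
  ext p
  simp only [slice_apply, prefixEquiv_apply, tmul_apply]
  exact mul_comm _ _

theorem inner_comul_flip (T : Fock d →L[ℂ] Fock d) (x x' y y' : Fock d) :
    ⟪tmul y y', comul T (tmul x x')⟫_ℂ = ⟪tmul y' y, comul T (tmul x' x)⟫_ℂ := by
  rw [comul, ← (hasSum_inner_ampliation _ T _ _).tsum_eq,
    ← (hasSum_inner_ampliation _ T _ _).tsum_eq, ← CoprimePair.swap.tsum_eq]
  simp only [slice_tmul_swap]

/-- The slice map `(ω_{x,y} ⊗ id) ∘ Δ`. -/
def sliceMap (x y : Fock d) (T : Fock d →L[ℂ] Fock d) : Fock d →L[ℂ] Fock d :=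
  ContinuousLinearMap.adjoint (tmul y) ∘L comul T ∘L tmul x

theorem inner_sliceMap (x y z z' : Fock d) (T : Fock d →L[ℂ] Fock d) :
    ⟪z', sliceMap x y T z⟫_ℂ = ⟪tmul y z', comul T (tmul x z)⟫_ℂ := by
  simp [sliceMap, ContinuousLinearMap.adjoint_inner_right]

theorem sliceMap_leftShift (x y : Fock d) (w : Word d) :
    sliceMap x y (leftShift w) = ⟪y, leftShift w x⟫_ℂ • leftShift w := by
  ext1 z
  refine ext_inner_left ℂ fun z' => ?_
  rw [inner_sliceMap, comul_leftShift, tensorOp_tmul, inner_tmul]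
  simp [inner_smul_right]

theorem sliceMap_smul (x y : Fock d) (c : ℂ) (T : Fock d →L[ℂ] Fock d) :
    sliceMap x y (c • T) = c • sliceMap x y T := by
  ext1 z
  refine ext_inner_left ℂ fun z' => ?_
  rw [inner_sliceMap, comul_smul, smul_apply, smul_apply,
    inner_smul_right, inner_smul_right, inner_sliceMap]

theorem sliceMap_zero (x y : Fock d) : sliceMap x y 0 = 0 := by
  simpa using sliceMap_smul x y 0 0

theorem continuous_wot_inner (x y : Fock d) :
    Continuous fun T : Fock d →WOT[ℂ] Fock d => ⟪y, T.toCLM x⟫_ℂ :=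
  (ContinuousLinearMapWOT.continuous_iff (𝕜 := ℂ) (f := fun T : Fock d →WOT[ℂ] Fock d => T)).1
    continuous_id x y

/-- Evaluation of matrix coefficients, as a linear functional. -/
def coeff (x y : Fock d) : (Fock d →L[ℂ] Fock d) →ₗ[ℂ] ℂ where
  toFun T := ⟪y, T x⟫_ℂ
  map_add' S T := by simp
  map_smul' c T := by simp

theorem inner_comul_ket {T : Fock d →L[ℂ] Fock d} (hT : T ∈ toeplitz d) (a u : Word d)
    (y v : Fock d) (c : ℂ)
    (h : ∀ w', ⟪y, leftShift w' (ket a)⟫_ℂ * ⟪v, leftShift w' (ket u)⟫_ℂ =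
      c * ⟪y, leftShift w' (ket a)⟫_ℂ) :
    ⟪tmul y v, comul T (tmul (ket a) (ket u))⟫_ℂ = c * ⟪y, T (ket a)⟫_ℂ := by
  obtain ⟨⟨p, m⟩, hp⟩ := (prefixEquiv d).surjective (a, u)
  have key : ∀ T : Fock d →L[ℂ] Fock d, ⟪tmul y v, comul T (tmul (ket a) (ket u))⟫_ℂ =
      ⟪slice (prefixEquiv d) m (tmul y v), T (ket p)⟫_ℂ := by
    intro T
    rw [← ket_prod, ← hp, comul, inner_ampliation_ket]
  let f : (Fock d →L[ℂ] Fock d) →ₗ[ℂ] ℂ :=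
    coeff (ket p) (slice (prefixEquiv d) m (tmul y v)) - c • coeff (ket a) y
  have hf : f T = 0 := by
    refine toeplitz_induction f ?_ (fun w' => ?_) hT
    · exact (continuous_wot_inner _ _).sub ((continuous_wot_inner _ _).const_smul c)
    · change ⟪slice (prefixEquiv d) m (tmul y v), leftShift w' (ket p)⟫_ℂ -
        c * ⟪y, leftShift w' (ket a)⟫_ℂ = 0
      rw [← key, comul_leftShift, tensorOp_tmul, inner_tmul, h, sub_self]
  rw [key]
  exact sub_eq_zero.1 hf

theorem sliceMap_ket {T : Fock d →L[ℂ] Fock d} (hT : T ∈ toeplitz d) (a w : Word d) :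
    sliceMap (ket a) (ket (w * a)) T = ⟪ket (w * a), T (ket a)⟫_ℂ • leftShift w := by
  refine clm_ext_ket fun u => ext_inner_left ℂ fun v => ?_
  rw [inner_sliceMap, inner_comul_ket hT a u _ v ⟪v, leftShift w (ket u)⟫_ℂ]
  · simp [inner_smul_right, mul_comm]
  · intro w'
    by_cases hw : w' = w
    · rw [hw, mul_comm]
    · rw [leftShift_ket, inner_ket, ket_ne (by simpa using Ne.symm hw)]
      simp

theorem sliceMap_ket_zero {T : Fock d →L[ℂ] Fock d} (hT : T ∈ toeplitz d) (a b : Word d)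
    (hb : ¬∃ w, b = w * a) : sliceMap (ket a) (ket b) T = 0 := by
  refine clm_ext_ket fun u => ext_inner_left ℂ fun v => ?_
  rw [inner_sliceMap, inner_comul_ket hT a u _ v 0]
  · simp
  · intro w'
    rw [leftShift_ket, inner_ket, ket_ne (fun h => hb ⟨w', h⟩)]
    simp

theorem sesq_induction {W : Type*} [NormedAddCommGroup W] [NormedSpace ℂ W]
    {V : Submodule ℂ W} (hV : IsClosed (V : Set W)) (G : Fock d → Fock d → W)
    (h1 : ∀ y, ∃ g : Fock d →L[ℂ] W, ∀ x, g x = G x y)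
    (h2 : ∀ x, ∃ g : Fock d →L⋆[ℂ] W, ∀ y, g y = G x y)
    (h : ∀ a b, G (ket a) (ket b) ∈ V) (x y : Fock d) : G x y ∈ V := by
  have h3 : ∀ x b, G x (ket b) ∈ V := by
    intro x b
    obtain ⟨g, hg⟩ := h1 (ket b)
    rw [← hg]
    exact Ell2.mem_of_ket (V := V.comap (g : Fock d →ₗ[ℂ] W)) (hV.preimage g.continuous)
      (fun a => by change g (ket a) ∈ V; rw [hg]; exact h a b) x
  obtain ⟨g, hg⟩ := h2 x
  rw [← hg]
  exact Ell2.mem_of_ket (V := V.comap (g : Fock d →ₛₗ[starRingEnd ℂ] W)) (hV.preimage g.continuous)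
    (fun b => by change g (ket b) ∈ V; rw [hg]; exact h3 x b) y

theorem sliceMap_clm_left (y : Fock d) (T : Fock d →L[ℂ] Fock d) :
    ∃ g : Fock d →L[ℂ] (Fock d →L[ℂ] Fock d), ∀ x, g x = sliceMap x y T :=
  ⟨ContinuousLinearMap.compL ℂ (Fock d) (Fock2 d) (Fock d)
    (ContinuousLinearMap.adjoint (tmul y) ∘L comul T) ∘L tmul, fun x => by
      rw [ContinuousLinearMap.comp_apply, ContinuousLinearMap.compL_apply, sliceMap,
        ContinuousLinearMap.comp_assoc]⟩

theorem sliceMap_clm_right (x : Fock d) (T : Fock d →L[ℂ] Fock d) :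
    ∃ g : Fock d →L⋆[ℂ] (Fock d →L[ℂ] Fock d), ∀ y, g y = sliceMap x y T :=
  ⟨((ContinuousLinearMap.compL ℂ (Fock d) (Fock2 d) (Fock d)).flip (comul T ∘L tmul x)).comp
    ((ContinuousLinearMap.adjoint : (Fock d →L[ℂ] Fock2 d) ≃ₗᵢ⋆[ℂ]
      (Fock2 d →L[ℂ] Fock d)).toContinuousLinearEquiv.toContinuousLinearMap.comp tmul),
    fun _ => rfl⟩

/-- `Δ` as a bounded linear map. -/
def comulCLM : (Fock d →L[ℂ] Fock d) →L[ℂ] (Fock2 d →L[ℂ] Fock2 d) :=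
  LinearMap.mkContinuous
    { toFun := comul
      map_add' := comul_add
      map_smul' := comul_smul } 1 (fun T => by
        rw [one_mul]
        exact norm_ampliation_le (prefixEquiv d) T)

theorem sliceMap_clm (x y : Fock d) :
    ∃ g : (Fock d →L[ℂ] Fock d) →L[ℂ] (Fock d →L[ℂ] Fock d), ∀ T, g T = sliceMap x y T :=
  ⟨ContinuousLinearMap.compL ℂ (Fock d) (Fock2 d) (Fock d) (ContinuousLinearMap.adjoint (tmul y)) ∘L
    (ContinuousLinearMap.compL ℂ (Fock d) (Fock2 d) (Fock2 d)).flip (tmul x) ∘L comulCLM,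
    fun _ => rfl⟩

theorem sliceMap_mem {T : Fock d →L[ℂ] Fock d} (hT : T ∈ toeplitz d) (x y : Fock d) :
    sliceMap x y T ∈ toeplitz d := by
  refine sesq_induction (V := Subalgebra.toSubmodule (toeplitz d)) isClosed_toeplitz
    (fun x y => sliceMap x y T) (fun y => sliceMap_clm_left y T)
    (fun x => sliceMap_clm_right x T) (fun a b => ?_) x y
  by_cases hb : ∃ w, b = w * a
  · obtain ⟨w, rfl⟩ := hb
    rw [sliceMap_ket hT]
    exact Submodule.smul_mem _ _ (leftShift_mem w)
  · rw [sliceMap_ket_zero hT a b hb]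
    exact Submodule.zero_mem _

theorem sliceMap_comm {T : Fock d →L[ℂ] Fock d} (hT : T ∈ toeplitz d) (x y x' y' : Fock d) :
    sliceMap x' y' (sliceMap x y T) = sliceMap x y (sliceMap x' y' T) := by
  obtain ⟨g, hg⟩ := sliceMap_clm x' y'
  have key := sesq_induction (V := (⊥ : Submodule ℂ (Fock d →L[ℂ] Fock d)))
    (by simp) (fun x y => sliceMap x' y' (sliceMap x y T) - sliceMap x y (sliceMap x' y' T))
    (fun y => ?_) (fun x => ?_) (fun a b => ?_) x y
  · exact sub_eq_zero.1 key
  · obtain ⟨g₁, h₁⟩ := sliceMap_clm_left y T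
    obtain ⟨g₂, h₂⟩ := sliceMap_clm_left y (sliceMap x' y' T)
    exact ⟨g ∘L g₁ - g₂, fun x => by simp [h₁, h₂, hg]⟩
  · obtain ⟨g₁, h₁⟩ := sliceMap_clm_right x T
    obtain ⟨g₂, h₂⟩ := sliceMap_clm_right x (sliceMap x' y' T)
    exact ⟨g.comp g₁ - g₂, fun x => by simp [h₁, h₂, hg]⟩
  · refine sub_eq_zero.2 ?_
    have hT' := sliceMap_mem hT x' y'
    by_cases hb : ∃ w, b = w * a
    · obtain ⟨w, rfl⟩ := hb
      rw [sliceMap_ket hT, sliceMap_ket hT', inner_sliceMap, inner_comul_flip, ← inner_sliceMap,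
        sliceMap_ket hT, sliceMap_smul, sliceMap_leftShift, smul_smul,
        smul_apply, inner_smul_right]
    · rw [sliceMap_ket_zero hT a b hb, sliceMap_ket_zero hT' a b hb, sliceMap_zero]

end SliceMaps

namespace HopfIdeal

variable {d : ℕ} (J : HopfIdeal d)

theorem inner_coideal {A : Fock d →L[ℂ] Fock d} (hA : A ∈ J.carrier) {z : Fock2 d}
    (hz : z ∈ J.space2) (u v : Word d) : ⟪z, comul A (ket (u, v))⟫_ℂ = 0 := by
  have hcl : @IsClosed _ (ultraweak (Fock2 d))
      {T : Fock2 d →L[ℂ] Fock2 d | ⟪z, T (ket (u, v))⟫_ℂ = 0} :=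
    @IsClosed.preimage _ _ (ultraweak (Fock2 d)) _ _ (continuous_ultraweak_inner (ket (u, v)) z)
      {0} isClosed_singleton
  refine @closure_minimal _ (ultraweak (Fock2 d)) _ _ ?_ hcl _ (J.coideal A hA)
  intro T hT
  have hle : Submodule.span ℂ {T : Fock2 d →L[ℂ] Fock2 d | ∃ C D : Fock d →L[ℂ] Fock d,
      (C ∈ J.carrier ∧ D ∈ toeplitz d ∨ C ∈ toeplitz d ∧ D ∈ J.carrier) ∧ T = tensorOp C D} ≤
      LinearMap.ker ((innerSL ℂ z ∘L ContinuousLinearMap.apply ℂ (Fock2 d) (ket (u, v)) :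
        (Fock2 d →L[ℂ] Fock2 d) →L[ℂ] ℂ) : (Fock2 d →L[ℂ] Fock2 d) →ₗ[ℂ] ℂ) := by
    rw [Submodule.span_le]
    rintro _ ⟨C, D, hCD, rfl⟩
    have hz' := J.space2_induction (V := (ℂ ∙ (tmul (C (ket u)) (D (ket v))))ᗮ)
      (Submodule.isClosed_orthogonal _) (fun x hx y hy => by
        rw [Submodule.mem_orthogonal_singleton_iff_inner_left, inner_tmul]
        rcases hCD with h | h
        · rw [J.inner_space hx h.1, zero_mul]
        · rw [J.inner_space hy h.2, mul_zero]) hz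
    rw [Submodule.mem_orthogonal_singleton_iff_inner_left] at hz'
    simpa [ket_prod, tensorOp_tmul] using hz'
  simpa using hle hT

theorem slice_mem {z : Fock2 d} (hz : z ∈ J.space2) (m : CoprimePair d) :
    slice (prefixEquiv d) m z ∈ J.space := by
  rw [mem_space_iff]
  intro A hA
  rw [← inner_ampliation_ket]
  exact J.inner_coideal hA hz _ _

/-- The columns of a vector in `N_J ⊗ N_J`. -/
def sliceJ (m : CoprimePair d) (z : J.space2) : J.space :=
  ⟨slice (prefixEquiv d) m z, J.slice_mem z.2 m⟩

theorem hasSum_inner_comulJ (B : J.space →L[ℂ] J.space) (x y : J.space2) :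
    HasSum (fun m => ⟪J.sliceJ m y, B (J.sliceJ m x)⟫_ℂ) ⟪y, J.comulJ B x⟫_ℂ := by
  rw [comulJ, inner_compress]
  have h := hasSum_inner_ampliation (prefixEquiv d) (extendByZero J.space B) (x : Fock2 d) y
  simp only [inner_extendByZero J.space B (J.slice_mem x.2 _) (J.slice_mem y.2 _)] at h
  exact h

/-- The defining property of the comultiplication of `𝓛_J`:
`Δ_J(π_J(A)) = (π_J ⊗ π_J)(Δ(A))`. -/
theorem comulJ_proj (A : Fock d →L[ℂ] Fock d) :
    J.comulJ (J.proj A) = compress J.space2 (comul A) := by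
  ext1 x
  refine ext_inner_left ℂ fun y => ?_
  rw [inner_compress]
  refine (J.hasSum_inner_comulJ (J.proj A) x y).unique ?_
  simp only [proj, inner_compress]
  exact hasSum_inner_ampliation (prefixEquiv d) A (x : Fock2 d) y

theorem comulJ_add (B C : J.space →L[ℂ] J.space) :
    J.comulJ (B + C) = J.comulJ B + J.comulJ C := by
  simp only [comulJ, map_add, comul_add]

theorem comulJ_smul (c : ℂ) (B : J.space →L[ℂ] J.space) :
    J.comulJ (c • B) = c • J.comulJ B := by
  simp only [comulJ, map_smul, comul_smul]

theorem norm_inner_comulJ_le (B : J.space →L[ℂ] J.space) (x y : J.space2) :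
    ‖⟪y, J.comulJ B x⟫_ℂ‖ ≤ ‖B‖ * (‖x‖ * ‖y‖) := by
  have h := summable_norm_slice_mul (prefixEquiv d) (x : Fock2 d) y
  rw [← (J.hasSum_inner_comulJ B x y).tsum_eq]
  refine (tsum_of_norm_bounded (h.1.mul_left ‖B‖).hasSum
    fun m => norm_inner_apply_le B (J.sliceJ m x) (J.sliceJ m y)).trans ?_
  rw [tsum_mul_left]
  exact mul_le_mul_of_nonneg_left h.2 (norm_nonneg B)

/-- `x ⊗ y ∈ N_J ⊗ N_J`, for `x, y ∈ N_J`. -/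
def tmulJ (x y : J.space) : J.space2 := ⟨tmul (x : Fock d) (y : Fock d), J.tmul_mem x.2 y.2⟩

theorem norm_tmulJ (x y : J.space) : ‖J.tmulJ x y‖ = ‖x‖ * ‖y‖ := norm_tmul _ _

/-- The predual `(𝓛_J)_*`. -/
def Predual : Type := NCToeplitz.Predual J.algebra

instance : NormedAddCommGroup J.Predual :=
  inferInstanceAs (NormedAddCommGroup (NCToeplitz.Predual J.algebra))
instance : NormedSpace ℂ J.Predual :=
  inferInstanceAs (NormedSpace ℂ (NCToeplitz.Predual J.algebra))
instance : CompleteSpace J.Predual :=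
  inferInstanceAs (CompleteSpace (NCToeplitz.Predual J.algebra))
instance : FunLike J.Predual J.algebra ℂ where
  coe φ B := φ.1 B
  coe_injective _ _ h := Subtype.ext (LinearMap.ext fun B => congrFun h B)

/-- The functional `φ ⊗ ψ` on operators on `N_J ⊗ N_J`: if `φ = ∑ₙ ⟨· xₙ, yₙ⟩` and
`ψ = ∑ₙ ⟨· x'ₙ, y'ₙ⟩`, then `φ ⊗ ψ = ∑ₙₘ ⟨· (xₙ ⊗ x'ₘ), yₙ ⊗ y'ₘ⟩`. -/
def tensorFunctional (φ ψ : J.Predual) (T : J.space2 →L[ℂ] J.space2) : ℂ :=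
  ∑' p : ℕ × ℕ, ⟪J.tmulJ (φ.2.choose_spec.choose p.1) (ψ.2.choose_spec.choose p.2),
    T (J.tmulJ (φ.2.choose p.1) (ψ.2.choose p.2))⟫_ℂ

theorem summable_tmulJ {x y x' y' : ℕ → J.space} (h : Summable fun n => ‖x n‖ * ‖y n‖)
    (h' : Summable fun n => ‖x' n‖ * ‖y' n‖) :
    HasSum (fun p : ℕ × ℕ => ‖J.tmulJ (x p.1) (x' p.2)‖ * ‖J.tmulJ (y p.1) (y' p.2)‖)
      ((∑' n, ‖x n‖ * ‖y n‖) * ∑' n, ‖x' n‖ * ‖y' n‖) := by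
  have hm := h.hasSum.mul h'.hasSum (h.mul_of_nonneg h' (fun _ => by positivity)
    fun _ => by positivity)
  have heq : (fun p : ℕ × ℕ => ‖J.tmulJ (x p.1) (x' p.2)‖ * ‖J.tmulJ (y p.1) (y' p.2)‖) =
      fun p => ‖x p.1‖ * ‖y p.1‖ * (‖x' p.2‖ * ‖y' p.2‖) := by
    funext p
    rw [norm_tmulJ, norm_tmulJ]
    ring
  rw [heq]
  exact hm

theorem summable_inner_tmulJ {x y x' y' : ℕ → J.space} (h : Summable fun n => ‖x n‖ * ‖y n‖)
    (h' : Summable fun n => ‖x' n‖ * ‖y' n‖) (B : J.space →L[ℂ] J.space) :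
    Summable fun p : ℕ × ℕ =>
      ⟪J.tmulJ (y p.1) (y' p.2), J.comulJ B (J.tmulJ (x p.1) (x' p.2))⟫_ℂ :=
  summable_inner_apply (J.summable_tmulJ h h').summable (J.comulJ B)

/-- Functionals of the form `(φ ⊗ ψ) ∘ Δ_J` are ultraweakly continuous. -/
theorem exists_rep_conv {x y x' y' : ℕ → J.space} (h : Summable fun n => ‖x n‖ * ‖y n‖)
    (h' : Summable fun n => ‖x' n‖ * ‖y' n‖) (f : J.algebra →ₗ[ℂ] ℂ)
    (hf : ∀ B : J.algebra, f B = ∑' p : ℕ × ℕ,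
      ⟪J.tmulJ (y p.1) (y' p.2), J.comulJ B (J.tmulJ (x p.1) (x' p.2))⟫_ℂ) :
    ∃ hm : f ∈ NCToeplitz.Predual J.algebra, ‖(⟨f, hm⟩ : NCToeplitz.Predual J.algebra)‖ ≤
      (∑' n, ‖x n‖ * ‖y n‖) * ∑' n, ‖x' n‖ * ‖y' n‖ := by
  have hs := J.summable_tmulJ h h'
  have hsl := fun p : ℕ × ℕ => summable_norm_slice_mul (prefixEquiv d)
    (J.tmulJ (x p.1) (x' p.2) : Fock2 d) (J.tmulJ (y p.1) (y' p.2))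
  have h1 : Summable fun q : (ℕ × ℕ) × CoprimePair d =>
      ‖J.sliceJ q.2 (J.tmulJ (x q.1.1) (x' q.1.2))‖ *
        ‖J.sliceJ q.2 (J.tmulJ (y q.1.1) (y' q.1.2))‖ := by
    rw [summable_prod_of_nonneg fun q => by positivity]
    exact ⟨fun p => (hsl p).1, Summable.of_nonneg_of_le (fun p => tsum_nonneg fun _ => by positivity)
      (fun p => (hsl p).2) hs.summable⟩
  have h2 : ∀ B : J.algebra, f B = ∑' q : (ℕ × ℕ) × CoprimePair d,
      ⟪J.sliceJ q.2 (J.tmulJ (y q.1.1) (y' q.1.2)),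
        (B : J.space →L[ℂ] J.space) (J.sliceJ q.2 (J.tmulJ (x q.1.1) (x' q.1.2)))⟫_ℂ := by
    intro B
    rw [(summable_inner_apply h1 _).tsum_prod, hf]
    exact tsum_congr fun p => (J.hasSum_inner_comulJ B _ _).tsum_eq.symm
  have h3 : f ∈ NCToeplitz.Predual J.algebra := by
    obtain ⟨x', y', h', -⟩ := exists_traceRep h1 h2
    exact ⟨x', y', h'⟩
  refine ⟨h3, (Predual.norm_le ⟨f, h3⟩ h1 h2).trans ?_⟩
  rw [h1.tsum_prod, ← hs.tsum_eq]
  exact h1.prod.tsum_le_tsum (fun p => (hsl p).2) hs.summable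

theorem rep_spec (φ : J.Predual) : IsTraceRep φ.1 φ.2.choose φ.2.choose_spec.choose :=
  φ.2.choose_spec.choose_spec

/-- The functional `(φ ⊗ ψ) ∘ Δ_J` on `𝓛_J`. -/
def convFunctional (φ ψ : J.Predual) : J.algebra →ₗ[ℂ] ℂ where
  toFun B := J.tensorFunctional φ ψ (J.comulJ B)
  map_add' B C := by
    simp only [tensorFunctional, Submodule.coe_add, comulJ_add, add_apply,
      inner_add_right]
    exact (J.summable_inner_tmulJ (J.rep_spec φ).1 (J.rep_spec ψ).1 B).tsum_add
      (J.summable_inner_tmulJ (J.rep_spec φ).1 (J.rep_spec ψ).1 C)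
  map_smul' c B := by
    simp only [tensorFunctional, Submodule.coe_smul, comulJ_smul, smul_apply,
      RingHom.id_apply, smul_eq_mul]
    rw [← tsum_mul_left]
    exact tsum_congr fun p => (innerSL ℂ _).map_smul c _

/-- The convolution product `φ ⋆ ψ = (φ ⊗ ψ) ∘ Δ_J` on the predual of `𝓛_J`. -/
instance : Mul J.Predual where
  mul φ ψ := ⟨J.convFunctional φ ψ, (J.exists_rep_conv (J.rep_spec φ).1 (J.rep_spec ψ).1
    (J.convFunctional φ ψ) fun _ => rfl).1⟩

theorem mul_apply (φ ψ : J.Predual) (B : J.algebra) :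
    (φ * ψ) B = J.tensorFunctional φ ψ (J.comulJ B) := rfl

theorem tmulJ_flip (x x' y y' : J.space) (B : J.space →L[ℂ] J.space) :
    ⟪J.tmulJ y y', J.comulJ B (J.tmulJ x x')⟫_ℂ = ⟪J.tmulJ y' y, J.comulJ B (J.tmulJ x' x)⟫_ℂ := by
  rw [comulJ, inner_compress, inner_compress]
  exact inner_comul_flip _ _ _ _ _

theorem mul_comm' (φ ψ : J.Predual) : φ * ψ = ψ * φ := by
  refine Subtype.ext (LinearMap.ext fun B => ?_)
  change J.tensorFunctional φ ψ (J.comulJ B) = J.tensorFunctional ψ φ (J.comulJ B)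
  rw [tensorFunctional, tensorFunctional, ← (Equiv.prodComm ℕ ℕ).tsum_eq]
  exact tsum_congr fun p => J.tmulJ_flip _ _ _ _ _

theorem exists_sliceJ (x y : J.space) (B : J.algebra) : ∃ C : J.algebra,
    ∀ z z' : J.space, ⟪z', (C : J.space →L[ℂ] J.space) z⟫_ℂ =
      ⟪J.tmulJ y z', J.comulJ B (J.tmulJ x z)⟫_ℂ := by
  obtain ⟨_, A, hA, rfl⟩ := B
  refine ⟨⟨J.proj (sliceMap x y A), _, sliceMap_mem hA x y, rfl⟩, fun z z' => ?_⟩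
  change ⟪z', J.proj (sliceMap x y A) z⟫_ℂ = ⟪J.tmulJ y z', J.comulJ (J.proj A) (J.tmulJ x z)⟫_ℂ
  rw [proj, inner_compress, inner_sliceMap]
  change _ = ⟪J.tmulJ y z', J.comulJ (J.proj A) (J.tmulJ x z)⟫_ℂ
  rw [comulJ_proj, inner_compress]
  rfl

/-- The slice map `(ω_{x,y} ⊗ id) ∘ Δ_J` of `𝓛_J`. -/
def sliceMapJ (x y : J.space) (B : J.algebra) : J.algebra := (J.exists_sliceJ x y B).choose

theorem inner_sliceMapJ (x y z z' : J.space) (B : J.algebra) :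
    ⟪z', (J.sliceMapJ x y B : J.space →L[ℂ] J.space) z⟫_ℂ =
      ⟪J.tmulJ y z', J.comulJ B (J.tmulJ x z)⟫_ℂ :=
  (J.exists_sliceJ x y B).choose_spec z z'

theorem sliceMapJ_proj (x y : J.space) (A : Fock d →L[ℂ] Fock d) (hA : A ∈ toeplitz d) :
    J.sliceMapJ x y ⟨J.proj A, A, hA, rfl⟩ =
      ⟨J.proj (sliceMap x y A), _, sliceMap_mem hA x y, rfl⟩ := by
  refine Subtype.ext (ContinuousLinearMap.ext fun z => ext_inner_left ℂ fun z' => ?_)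
  rw [inner_sliceMapJ]
  change ⟪J.tmulJ y z', J.comulJ (J.proj A) (J.tmulJ x z)⟫_ℂ = ⟪z', J.proj (sliceMap x y A) z⟫_ℂ
  rw [comulJ_proj, inner_compress, proj, inner_compress, inner_sliceMap]
  rfl

theorem sliceMapJ_comm (x y x' y' : J.space) (B : J.algebra) :
    J.sliceMapJ x' y' (J.sliceMapJ x y B) = J.sliceMapJ x y (J.sliceMapJ x' y' B) := by
  obtain ⟨_, A, hA, rfl⟩ := B
  rw [J.sliceMapJ_proj x y A hA, J.sliceMapJ_proj x' y' A hA,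
    J.sliceMapJ_proj x' y' _ (sliceMap_mem hA x y), J.sliceMapJ_proj x y _ (sliceMap_mem hA x' y')]
  simp only [sliceMap_comm hA]

theorem norm_sliceMapJ_le (x y : J.space) (B : J.algebra) :
    ‖(J.sliceMapJ x y B : J.space →L[ℂ] J.space)‖ ≤
      ‖x‖ * ‖y‖ * ‖(B : J.space →L[ℂ] J.space)‖ := by
  refine ContinuousLinearMap.opNorm_le_bound _ (by positivity) fun z => ?_
  set C : J.space →L[ℂ] J.space := (J.sliceMapJ x y B).1 with hC
  by_cases h0 : ‖C z‖ = 0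
  · rw [h0]; positivity
  have h1 : ‖C z‖ * ‖C z‖ ≤ ‖(B : J.space →L[ℂ] J.space)‖ * ((‖x‖ * ‖z‖) * (‖y‖ * ‖C z‖)) := by
    have := J.norm_inner_comulJ_le B (J.tmulJ x z) (J.tmulJ y (C z))
    rwa [← inner_sliceMapJ, norm_tmulJ, norm_tmulJ, ← hC, inner_self_eq_norm_sq_to_K,
      norm_pow, RCLike.norm_ofReal, abs_norm, sq] at this
  have h2 : 0 < ‖C z‖ := lt_of_le_of_ne (norm_nonneg _) (Ne.symm h0)
  refine le_of_mul_le_mul_right (h1.trans (le_of_eq ?_)) h2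
  ring

end HopfIdeal

namespace HopfIdeal

variable {d : ℕ} (J : HopfIdeal d)

theorem exists_rep (φ : J.Predual) : ∃ x y : ℕ → J.space, IsTraceRep φ.1 x y := φ.2

/-- `(φ ⋆ ψ)(B) = ∑ₙ ψ((ω_{xₙ,yₙ} ⊗ id)(Δ_J(B)))` if `φ = ∑ₙ ω_{xₙ,yₙ}`. -/
theorem tsum_conv_eq {x y x' y' : ℕ → J.space} {ψ : J.Predual}
    (h : Summable fun n => ‖x n‖ * ‖y n‖) (h' : IsTraceRep ψ.1 x' y') (B : J.algebra) :
    ∑' p : ℕ × ℕ, ⟪J.tmulJ (y p.1) (y' p.2), J.comulJ B (J.tmulJ (x p.1) (x' p.2))⟫_ℂ =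
      ∑' n, ψ (J.sliceMapJ (x n) (y n) B) := by
  rw [(J.summable_inner_tmulJ h h'.1 B).tsum_prod]
  refine tsum_congr fun n => ?_
  refine Eq.trans ?_ (h'.2 _).symm
  exact tsum_congr fun m => (J.inner_sliceMapJ _ _ _ _ _).symm

theorem conv_rep_indep {x y x' y' x₁ y₁ x₂ y₂ : ℕ → J.space} {φ ψ : J.Predual}
    (h : IsTraceRep φ.1 x y) (h' : IsTraceRep ψ.1 x' y') (h₁ : IsTraceRep φ.1 x₁ y₁)
    (h₂ : IsTraceRep ψ.1 x₂ y₂) (B : J.algebra) :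
    ∑' p : ℕ × ℕ, ⟪J.tmulJ (y p.1) (y' p.2), J.comulJ B (J.tmulJ (x p.1) (x' p.2))⟫_ℂ =
      ∑' p : ℕ × ℕ, ⟪J.tmulJ (y₁ p.1) (y₂ p.2), J.comulJ B (J.tmulJ (x₁ p.1) (x₂ p.2))⟫_ℂ := by
  have flip : ∀ a b a' b' : ℕ → J.space,
      ∑' p : ℕ × ℕ, ⟪J.tmulJ (b p.1) (b' p.2), J.comulJ B (J.tmulJ (a p.1) (a' p.2))⟫_ℂ =
      ∑' p : ℕ × ℕ, ⟪J.tmulJ (b' p.1) (b p.2), J.comulJ B (J.tmulJ (a' p.1) (a p.2))⟫_ℂ := by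
    intro a b a' b'
    rw [← (Equiv.prodComm ℕ ℕ).tsum_eq]
    exact tsum_congr fun p => J.tmulJ_flip _ _ _ _ _
  have e1 := (J.tsum_conv_eq h.1 h' B).trans (J.tsum_conv_eq h.1 h₂ B).symm
  have e2 := (J.tsum_conv_eq h₂.1 h B).trans (J.tsum_conv_eq h₂.1 h₁ B).symm
  exact e1.trans ((flip _ _ _ _).trans (e2.trans (flip _ _ _ _)))

/-- The value of the convolution does not depend on the representations. -/
theorem mul_apply_rep {x y x' y' : ℕ → J.space} {φ ψ : J.Predual} (h : IsTraceRep φ.1 x y)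
    (h' : IsTraceRep ψ.1 x' y') (B : J.algebra) : (φ * ψ) B = ∑' p : ℕ × ℕ,
      ⟪J.tmulJ (y p.1) (y' p.2), J.comulJ B (J.tmulJ (x p.1) (x' p.2))⟫_ℂ :=
  J.conv_rep_indep (J.rep_spec φ) (J.rep_spec ψ) h h' B

theorem mul_apply_left {x y : ℕ → J.space} {φ : J.Predual} (h : IsTraceRep φ.1 x y)
    (ψ : J.Predual) (B : J.algebra) : (φ * ψ) B = ∑' n, ψ (J.sliceMapJ (x n) (y n) B) :=
  (J.mul_apply_rep h (J.rep_spec ψ) B).trans (J.tsum_conv_eq h.1 (J.rep_spec ψ) B)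

theorem norm_apply_slice_le {x y : J.space} (ψ : J.Predual) (B : J.algebra) :
    ‖ψ (J.sliceMapJ x y B)‖ ≤ ‖ψ‖ * ‖(B : J.space →L[ℂ] J.space)‖ * (‖x‖ * ‖y‖) := by
  refine (Predual.norm_apply_le ψ _).trans ?_
  have := mul_le_mul_of_nonneg_left (J.norm_sliceMapJ_le x y B) (norm_nonneg ψ)
  refine le_trans this (le_of_eq ?_)
  ring

theorem summable_apply_slice {x y : ℕ → J.space} (h : Summable fun n => ‖x n‖ * ‖y n‖)
    (ψ : J.Predual) (B : J.algebra) : Summable fun n => ψ (J.sliceMapJ (x n) (y n) B) :=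
  Summable.of_norm_bounded (h.mul_left _) fun _ => J.norm_apply_slice_le ψ B

theorem mul_add' (φ ψ χ : J.Predual) : φ * (ψ + χ) = φ * ψ + φ * χ := by
  refine DFunLike.ext _ _ fun B => ?_
  change (φ * (ψ + χ)) B = (φ * ψ) B + (φ * χ) B
  obtain ⟨x, y, h⟩ := J.exists_rep φ
  rw [J.mul_apply_left h, J.mul_apply_left h, J.mul_apply_left h,
    ← (J.summable_apply_slice h.1 ψ B).tsum_add (J.summable_apply_slice h.1 χ B)]
  rfl

theorem mul_smul' (c : ℂ) (φ ψ : J.Predual) : φ * (c • ψ) = c • (φ * ψ) := by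
  refine DFunLike.ext _ _ fun B => ?_
  change (φ * (c • ψ)) B = c * (φ * ψ) B
  obtain ⟨x, y, h⟩ := J.exists_rep φ
  rw [J.mul_apply_left h, J.mul_apply_left h, ← tsum_mul_left]
  rfl

theorem mul_left_comm' (φ ψ χ : J.Predual) : φ * (ψ * χ) = ψ * (φ * χ) := by
  refine DFunLike.ext _ _ fun B => ?_
  obtain ⟨x, y, h⟩ := J.exists_rep φ
  obtain ⟨x', y', h'⟩ := J.exists_rep ψ
  rw [J.mul_apply_left h, J.mul_apply_left h']
  simp only [J.mul_apply_left h, J.mul_apply_left h']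
  have hs : Summable (Function.uncurry fun n m => χ (J.sliceMapJ (x' m) (y' m)
      (J.sliceMapJ (x n) (y n) B))) := by
    refine Summable.of_norm_bounded ((h.1.mul_of_nonneg h'.1 (fun _ => by positivity)
      fun _ => by positivity).mul_left (‖χ‖ * ‖(B : J.space →L[ℂ] J.space)‖)) fun p => ?_
    refine (J.norm_apply_slice_le χ _).trans ?_
    have h1 := J.norm_sliceMapJ_le (x p.1) (y p.1) B
    refine (mul_le_mul_of_nonneg_right (mul_le_mul_of_nonneg_left h1 (norm_nonneg χ))
      (by positivity)).trans (le_of_eq ?_)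
    ring
  refine hs.tsum_comm.symm.trans ?_
  exact tsum_congr fun m => tsum_congr fun n => by rw [sliceMapJ_comm]

theorem norm_mul_le' (φ ψ : J.Predual) : ‖φ * ψ‖ ≤ ‖φ‖ * ‖ψ‖ := by
  have key : ∀ ε : ℝ, 0 < ε → ‖φ * ψ‖ ≤ (‖φ‖ + ε) * (‖ψ‖ + ε) := by
    intro ε hε
    obtain ⟨x, y, h, hlt⟩ := Predual.exists_rep_lt φ hε
    obtain ⟨x', y', h', hlt'⟩ := Predual.exists_rep_lt ψ hε
    have hc := J.exists_rep_conv h.1 h'.1 (φ * ψ).1 (J.mul_apply_rep h h')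
    refine hc.2.trans ?_
    exact mul_le_mul hlt.le hlt'.le (tsum_nonneg fun _ => by positivity)
      (add_nonneg (norm_nonneg φ) hε.le)
  have ht : Filter.Tendsto (fun ε : ℝ => (‖φ‖ + ε) * (‖ψ‖ + ε)) (nhdsWithin 0 (Set.Ioi 0))
      (nhds ((‖φ‖ + 0) * (‖ψ‖ + 0))) :=
    (Continuous.tendsto (by fun_prop) 0).mono_left nhdsWithin_le_nhds
  simp only [add_zero] at ht
  exact ge_of_tendsto ht (Filter.eventually_of_mem self_mem_nhdsWithin key)

end HopfIdeal

namespace HopfIdeal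

variable {d : ℕ} (J : HopfIdeal d)

/-- The predual of `𝓛_J` is a commutative Banach algebra. -/
instance : NonUnitalNormedCommRing J.Predual :=
  { (inferInstance : NormedAddCommGroup J.Predual),
    (inferInstance : Mul J.Predual) with
    left_distrib := J.mul_add'
    right_distrib := fun φ ψ χ => by
      rw [J.mul_comm', J.mul_add', J.mul_comm' χ φ, J.mul_comm' χ ψ]
    zero_mul := fun φ => by
      have := J.mul_smul' 0 φ φ
      rwa [zero_smul, zero_smul, J.mul_comm'] at this
    mul_zero := fun φ => by
      have := J.mul_smul' 0 φ φ
      rwa [zero_smul, zero_smul] at this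
    mul_assoc := fun φ ψ χ => by
      rw [J.mul_comm', J.mul_left_comm', J.mul_comm' χ ψ]
    mul_comm := J.mul_comm'
    norm_mul_le := J.norm_mul_le' }

instance : SMulCommClass ℂ J.Predual J.Predual := ⟨fun c φ ψ => (J.mul_smul' c φ ψ).symm⟩

instance : IsScalarTower ℂ J.Predual J.Predual := ⟨fun c φ ψ => by
  change (c • φ) * ψ = c • (φ * ψ)
  rw [mul_comm, J.mul_smul', mul_comm]⟩

/-- The congruence on `𝔽_d^{*0}` associated with `J`: `u ∼ v` if and only if `L_u - L_v ∈ J`. -/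
def con : Con (WithZero (Word d)) where
  r u v := leftRegular₀ d u - leftRegular₀ d v ∈ J.carrier
  iseqv :=
    { refl := fun u => by simp
      symm := fun {u v} h => by simpa using J.carrier.neg_mem h
      trans := fun {u v w} h h' => by simpa using J.carrier.add_mem h h' }
  mul' {u u' v v'} h h' := by
    have h1 := J.mul_mem_left _ (leftRegular₀_mem u) _ h'
    have h2 := J.mul_mem_right _ (leftRegular₀_mem v') _ h
    have h3 := J.carrier.add_mem h1 h2
    rwa [mul_sub, sub_mul, sub_add_sub_cancel, ← map_mul, ← map_mul] at h3

/-- The semigroup `S = 𝔽_d^{*0} / ∼` associated with `J`. -/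
abbrev semigroup : Type := J.con.Quotient

/-- The zero element of the semigroup associated with `J`. -/
instance : Zero J.semigroup := ⟨((0 : WithZero (Word d)) : J.con.Quotient)⟩

/-- The operator `L_s = P_{N_J} L_w|_{N_J} ∈ 𝓛_J`, where `w` is any representative of `s ∈ S`. -/
def repr (s : J.semigroup) : J.algebra :=
  Con.liftOn s (fun w => ⟨J.proj (leftRegular₀ d w), _, leftRegular₀_mem w, rfl⟩) fun u v h => by
    have h' : J.proj (leftRegular₀ d u - leftRegular₀ d v) = 0 := J.proj_eq_zero h
    rw [map_sub, sub_eq_zero] at h'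
    exact Subtype.ext h'

end HopfIdeal

end NCToeplitz

end

/-! Evaluation at `L_s` is multiplicative because `Δ_J(L_s) = L_s ⊗ L_s`. It remains to see that
distinct `s` give distinct operators and that there are no further characters; homogeneity of `J`
enters in both.

Injectivity (`repr_injective`). The degree-`n` component of an operator `A` depends only on `A ξ_∅`,
through a norm-continuous map on Fock space. If `π_J(A) = 0`, then `A ξ_∅` is a limit of vectors `B
ξ_∅` with `B ∈ J`. Components of such `B` lie in `J` (`IsHomogeneous.homogeneousPart_mem`), hence so
do those of `A`. For `A = L_u - L_v` the components are so few that they force `u ∼ v`.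

Characters (`exists_eq_eval`). Let `ρ` be a nonzero character. Since `N_J` is graded, truncating
vectors keeps them in `N_J`, so `ρ(ω_{x,y}) ≠ 0` for some `x, y ∈ N_J` supported on words of length
less than some `n`. For such vectors the slice `(ω_{x,y} ⊗ id) ∘ Δ_J` takes values in the span of
the `L_w` with `|w| < n`. Hence `ω_{x,y} ⋆ ψ = 0` as soon as `ψ` vanishes at these finitely many
operators (`omega_mul_eq_zero`). If `ρ` differed from evaluation at each `L_w`, a finite product of
factors `ψ - ψ(L_w)` would yield `χ` with `ρ(χ) ≠ 0` and `χ(L_w) = 0` for all `|w| < n`. Then `0 =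
ρ(ω_{x,y} ⋆ χ) = ρ(ω_{x,y}) ρ(χ) ≠ 0`, a contradiction.

Semigroup-like elements. If `F ≠ 0` is semigroup-like, evaluation at `F` is a nonzero character,
hence evaluation at some `L_s`; the predual separates points, so `F = L_s`. -/

noncomputable section

namespace NCToeplitz

/-! ### Homogeneous components of operators in `𝓛_d`. -/

section Grading

variable {d : ℕ}

/-- The words of length `n`. -/
def wordsOfLength (d n : ℕ) : Finset (Word d) := (List.finite_length_eq (Fin d) n).toFinset

@[simp]
theorem mem_wordsOfLength {n : ℕ} {w : Word d} : w ∈ wordsOfLength d n ↔ w.length = n :=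
  Set.Finite.mem_toFinset _

/-- The polynomial `∑_{|w| = n} f(w) L_w`. -/
def homogeneousSymbol (d n : ℕ) : Fock d →L[ℂ] (Fock d →L[ℂ] Fock d) :=
  ∑ w ∈ wordsOfLength d n, (innerSL ℂ (ket w)).smulRight (leftShift w)

theorem homogeneousSymbol_apply (n : ℕ) (f : Fock d) :
    homogeneousSymbol d n f = ∑ w ∈ wordsOfLength d n, f w • leftShift w := by
  simp [homogeneousSymbol, inner_ket]

theorem homogeneousSymbol_ket (n : ℕ) (w : Word d) :
    homogeneousSymbol d n (ket w) = if w.length = n then leftShift w else 0 := by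
  rw [homogeneousSymbol_apply]
  split_ifs with h
  · rw [Finset.sum_eq_single w]
    · rw [ket_self, one_smul]
    · intro v _ hv
      rw [ket_ne hv, zero_smul]
    · simp [h]
  · refine Finset.sum_eq_zero fun v hv => ?_
    rw [ket_ne, zero_smul]
    rintro rfl
    exact h (mem_wordsOfLength.1 hv)

/-- The homogeneous component of degree `n` of an operator in `𝓛_d`. -/
def homogeneousPart (d n : ℕ) : (Fock d →L[ℂ] Fock d) →ₗ[ℂ] (Fock d →L[ℂ] Fock d) :=
  (homogeneousSymbol d n : Fock d →ₗ[ℂ] (Fock d →L[ℂ] Fock d)) ∘ₗ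
    (ContinuousLinearMap.apply ℂ (Fock d) (ket (1 : Word d)) : (Fock d →L[ℂ] Fock d) →ₗ[ℂ] Fock d)

/-- Factoring through the vector `T ξ_∅` is the point of the construction: the remaining map is norm
continuous on Fock space, so it can be applied to limits of vectors from `J ξ_∅` that are not known
to be of the form `B ξ_∅` with `B ∈ J`. -/
theorem homogeneousPart_eq (n : ℕ) (T : Fock d →L[ℂ] Fock d) :
    homogeneousPart d n T = homogeneousSymbol d n (T (ket 1)) := rfl

theorem homogeneousPart_leftShift (n : ℕ) (w : Word d) :
    homogeneousPart d n (leftShift w) = if w.length = n then leftShift w else 0 := by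
  rw [homogeneousPart_eq, leftShift_ket, mul_one, homogeneousSymbol_ket]

/-- The alphabet is finite, so each matrix coefficient of the component is a finite sum of constants
times coefficients of `T`; this is why WOT continuity survives. -/
theorem continuous_homogeneousPart (n : ℕ) : Continuous fun T : Fock d →WOT[ℂ] Fock d =>
    ContinuousLinearMapWOT.ofCLM (homogeneousPart d n T.toCLM) := by
  rw [ContinuousLinearMapWOT.continuous_iff (𝕜 := ℂ)]
  intro x y
  have h : (fun T : Fock d →WOT[ℂ] Fock d =>
      ⟪y, ContinuousLinearMapWOT.ofCLM (homogeneousPart d n T.toCLM) x⟫_ℂ) =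
      fun T => ∑ w ∈ wordsOfLength d n, ⟪ket w, T.toCLM (ket 1)⟫_ℂ * ⟪y, leftShift w x⟫_ℂ := by
    funext T
    change ⟪y, homogeneousPart d n T.toCLM x⟫_ℂ = _
    rw [homogeneousPart_eq, homogeneousSymbol_apply]
    simp [inner_ket]
  rw [h]
  exact continuous_finsetSum _ fun w _ => (continuous_wot_inner _ _).mul continuous_const

/-- Multiplication is used only as a separately WOT-continuous map; a left factor moves to the other
side of the inner product as its adjoint. -/
theorem continuous_mul_left_wot (S : Fock d →L[ℂ] Fock d) :
    Continuous fun T : Fock d →WOT[ℂ] Fock d => ContinuousLinearMapWOT.ofCLM (S * T.toCLM) := by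
  rw [ContinuousLinearMapWOT.continuous_iff (𝕜 := ℂ)]
  intro x y
  refine (continuous_wot_inner x (ContinuousLinearMap.adjoint S y)).congr fun T => ?_
  exact ContinuousLinearMap.adjoint_inner_left _ _ _

theorem continuous_mul_right_wot (S : Fock d →L[ℂ] Fock d) :
    Continuous fun T : Fock d →WOT[ℂ] Fock d => ContinuousLinearMapWOT.ofCLM (T.toCLM * S) := by
  rw [ContinuousLinearMapWOT.continuous_iff (𝕜 := ℂ)]
  exact fun x y => continuous_wot_inner (S x) y

/-- A WOT-closed subspace containing all `L_w` contains `𝓛_d`. -/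
theorem toeplitz_le {M : Submodule ℂ (Fock d →L[ℂ] Fock d)}
    (hM : IsClosed {T : Fock d →WOT[ℂ] Fock d | T.toCLM ∈ M}) (h : ∀ w, leftShift w ∈ M)
    {T : Fock d →L[ℂ] Fock d} (hT : T ∈ toeplitz d) : T ∈ M := by
  have hle : Subalgebra.toSubmodule (Algebra.adjoin ℂ (Set.range (leftShift (d := d)))) ≤ M := by
    rw [Algebra.adjoin_eq_span, Submodule.span_le]
    intro S hS
    -- The operators `L_w` already form a monoid, so the algebra they generate is just their linear
    -- span.
    have : Submonoid.closure (Set.range (leftShift (d := d))) ≤ MonoidHom.mrange (leftRegular d) :=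
      Submonoid.closure_le.2 (by rintro _ ⟨w, rfl⟩; exact ⟨w, rfl⟩)
    obtain ⟨w, rfl⟩ := this hS
    exact h w
  refine closure_minimal ?_ hM (mem_toeplitz_iff.1 hT)
  rintro _ ⟨S, hS, rfl⟩
  exact hle hS

/-- WOT-continuous linear maps that agree on all `L_w` agree on `𝓛_d`. -/
theorem toeplitz_ext (f g : (Fock d →L[ℂ] Fock d) →ₗ[ℂ] (Fock d →L[ℂ] Fock d))
    (hf : Continuous fun T : Fock d →WOT[ℂ] Fock d => ContinuousLinearMapWOT.ofCLM (f T.toCLM))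
    (hg : Continuous fun T : Fock d →WOT[ℂ] Fock d => ContinuousLinearMapWOT.ofCLM (g T.toCLM))
    (h : ∀ w, f (leftShift w) = g (leftShift w)) {T : Fock d →L[ℂ] Fock d} (hT : T ∈ toeplitz d) :
    f T = g T := by
  refine toeplitz_le (M := LinearMap.eqLocus f g) ?_ h hT
  convert isClosed_eq hf hg using 1
  ext T
  exact ContinuousLinearMapWOT.ofCLM_injective.eq_iff.symm

/-- Degrees add under multiplication. Both sides are linear and WOT continuous in `T`, so it
suffices to compare them at `T = L_w`. The case split is needed because `n - u.length` is truncated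
at zero and would otherwise pick out the constant term. -/
theorem homogeneousPart_leftShift_mul (n : ℕ) (u : Word d) {T : Fock d →L[ℂ] Fock d}
    (hT : T ∈ toeplitz d) : homogeneousPart d n (leftShift u * T) =
      if u.length ≤ n then leftShift u * homogeneousPart d (n - u.length) T else 0 := by
  have hmul : ∀ w : Word d, leftShift u * leftShift w = leftShift (u * w) :=
    fun w => (map_mul (leftRegular d) u w).symm
  split_ifs with hu
  · refine toeplitz_ext (homogeneousPart d n ∘ₗ LinearMap.mulLeft ℂ (leftShift u))
      (LinearMap.mulLeft ℂ (leftShift u) ∘ₗ homogeneousPart d (n - u.length))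
      ((continuous_homogeneousPart n).comp (continuous_mul_left_wot (leftShift u)))
      ((continuous_mul_left_wot (leftShift u)).comp (continuous_homogeneousPart _))
      (fun w => ?_) hT
    simp only [LinearMap.comp_apply, LinearMap.mulLeft_apply, hmul, homogeneousPart_leftShift,
      FreeMonoid.length_mul]
    have : u.length + w.length = n ↔ w.length = n - u.length := by omega
    simp [this, hmul]
  · refine toeplitz_ext (homogeneousPart d n ∘ₗ LinearMap.mulLeft ℂ (leftShift u)) 0
      ((continuous_homogeneousPart n).comp (continuous_mul_left_wot (leftShift u)))
      (continuous_const (y := (0 : Fock d →WOT[ℂ] Fock d))) (fun w => ?_) hT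
    simp only [LinearMap.comp_apply, LinearMap.mulLeft_apply, hmul, homogeneousPart_leftShift,
      FreeMonoid.length_mul]
    rw [if_neg (by omega), LinearMap.zero_apply]

theorem homogeneousPart_mul_leftShift (n : ℕ) (u : Word d) {T : Fock d →L[ℂ] Fock d}
    (hT : T ∈ toeplitz d) : homogeneousPart d n (T * leftShift u) =
      if u.length ≤ n then homogeneousPart d (n - u.length) T * leftShift u else 0 := by
  have hmul : ∀ w : Word d, leftShift w * leftShift u = leftShift (w * u) :=
    fun w => (map_mul (leftRegular d) w u).symm
  split_ifs with hu
  · refine toeplitz_ext (homogeneousPart d n ∘ₗ LinearMap.mulRight ℂ (leftShift u))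
      (LinearMap.mulRight ℂ (leftShift u) ∘ₗ homogeneousPart d (n - u.length))
      ((continuous_homogeneousPart n).comp (continuous_mul_right_wot (leftShift u)))
      ((continuous_mul_right_wot (leftShift u)).comp (continuous_homogeneousPart _))
      (fun w => ?_) hT
    simp only [LinearMap.comp_apply, LinearMap.mulRight_apply, hmul, homogeneousPart_leftShift,
      FreeMonoid.length_mul]
    have : w.length + u.length = n ↔ w.length = n - u.length := by omega
    simp [this, hmul]
  · refine toeplitz_ext (homogeneousPart d n ∘ₗ LinearMap.mulRight ℂ (leftShift u)) 0
      ((continuous_homogeneousPart n).comp (continuous_mul_right_wot (leftShift u)))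
      (continuous_const (y := (0 : Fock d →WOT[ℂ] Fock d))) (fun w => ?_) hT
    simp only [LinearMap.comp_apply, LinearMap.mulRight_apply, hmul, homogeneousPart_leftShift,
      FreeMonoid.length_mul]
    rw [if_neg (by omega), LinearMap.zero_apply]

/-! ### Homogeneous ideals are graded. -/

namespace ToeplitzIdeal

variable (J : ToeplitzIdeal d)

theorem isClosed_preimage_wot : IsClosed {T : Fock d →WOT[ℂ] Fock d | T.toCLM ∈ J.carrier} := by
  convert J.isClosed using 1
  ext T
  exact ⟨fun h => ⟨_, h, rfl⟩, by rintro ⟨S, hS, rfl⟩; exact hS⟩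

theorem isClosed_carrier : IsClosed (J.carrier : Set (Fock d →L[ℂ] Fock d)) :=
  J.isClosed_preimage_wot.preimage ContinuousLinearMapWOT.continuous_ofCLM

/-- The ideal of all operators in `𝓛_d` whose homogeneous components belong to `J`. -/
def gradedHull : ToeplitzIdeal d where
  carrier := Subalgebra.toSubmodule (toeplitz d) ⊓
    ⨅ n, J.carrier.comap (homogeneousPart d n)
  le_toeplitz A hA := hA.1
  mul_mem_left T hT A hA := by
    refine ⟨(toeplitz d).mul_mem hT hA.1, ?_⟩
    have hA2 : ∀ n, homogeneousPart d n A ∈ J.carrier := by simpa using hA.2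
    rw [SetLike.mem_coe, Submodule.mem_iInf]
    intro n
    -- With `A` fixed, the condition on `T` cuts out a WOT-closed subspace, so `T = L_w` suffices;
    -- there the component is `L_w` times a component of `A`, or zero.
    refine toeplitz_le (M := J.carrier.comap (homogeneousPart d n ∘ₗ LinearMap.mulRight ℂ A))
      (J.isClosed_preimage_wot.preimage
        ((continuous_homogeneousPart n).comp (continuous_mul_right_wot A))) (fun w => ?_) hT
    change homogeneousPart d n (leftShift w * A) ∈ J.carrier
    rw [homogeneousPart_leftShift_mul n w hA.1]
    split_ifs
    · exact J.mul_mem_left _ (leftShift_mem w) _ (hA2 _)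
    · exact J.carrier.zero_mem
  mul_mem_right T hT A hA := by
    refine ⟨(toeplitz d).mul_mem hA.1 hT, ?_⟩
    have hA2 : ∀ n, homogeneousPart d n A ∈ J.carrier := by simpa using hA.2
    rw [SetLike.mem_coe, Submodule.mem_iInf]
    intro n
    refine toeplitz_le (M := J.carrier.comap (homogeneousPart d n ∘ₗ LinearMap.mulLeft ℂ A))
      (J.isClosed_preimage_wot.preimage
        ((continuous_homogeneousPart n).comp (continuous_mul_left_wot A))) (fun w => ?_) hT
    change homogeneousPart d n (A * leftShift w) ∈ J.carrier
    rw [homogeneousPart_mul_leftShift n w hA.1]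
    split_ifs
    · exact J.mul_mem_right _ (leftShift_mem w) _ (hA2 _)
    · exact J.carrier.zero_mem
  isClosed := by
    have h1 : IsClosed {T : Fock d →WOT[ℂ] Fock d | T.toCLM ∈ toeplitz d} := isClosed_closure
    have h2 : IsClosed (⋂ n, {T : Fock d →WOT[ℂ] Fock d |
        homogeneousPart d n T.toCLM ∈ J.carrier}) :=
      isClosed_iInter fun n => J.isClosed_preimage_wot.preimage (continuous_homogeneousPart n)
    convert h1.inter h2 using 1
    ext T
    simp only [Set.mem_image, Set.mem_inter_iff, Set.mem_iInter, Set.mem_ofPred_eq]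
    constructor
    · rintro ⟨S, hS, rfl⟩
      exact ⟨hS.1, by simpa using hS.2⟩
    · rintro ⟨h, h'⟩
      exact ⟨T.toCLM, ⟨h, by simpa using h'⟩, rfl⟩

/-- The homogeneous components of an element of a homogeneous ideal belong to the ideal. -/
theorem IsHomogeneous.homogeneousPart_mem {J : ToeplitzIdeal d} (hJ : J.IsHomogeneous)
    {A : Fock d →L[ℂ] Fock d} (hA : A ∈ J.carrier) (n : ℕ) :
    homogeneousPart d n A ∈ J.carrier := by
  obtain ⟨P, hP, hPJ, hmin⟩ := hJ
  -- By minimality of `J` among closed ideals containing `P`, only the generators have to be placed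
  -- in the graded hull.
  have hA' : A ∈ J.gradedHull.carrier := by
    refine hmin J.gradedHull (fun B hB => ?_) hA
    refine ⟨J.le_toeplitz _ (hPJ hB), ?_⟩
    rw [SetLike.mem_coe, Submodule.mem_iInf]
    intro k
    obtain ⟨m, hm⟩ := hP B hB
    -- A homogeneous polynomial of degree `m` is its own component of degree `m` and has no other.
    have key : homogeneousPart d k B = if m = k then B else 0 := by
      clear hB
      induction hm using Submodule.span_induction with
      | mem x hx =>
        obtain ⟨w, rfl, rfl⟩ := hx
        exact homogeneousPart_leftShift k w
      | zero => simp
      | add x y _ _ hx hy => rw [map_add, hx, hy]; split_ifs <;> simp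
      | smul c x _ hx => rw [map_smul, hx]; split_ifs <;> simp
    change homogeneousPart d k B ∈ J.carrier
    rw [key]
    split_ifs
    · exact hPJ hB
    · exact J.carrier.zero_mem
  exact (Submodule.mem_iInf _).1 hA'.2 n

end ToeplitzIdeal

end Grading

/-! ### The kernel of `π_J` and injectivity of `s ↦ L_s`. -/

namespace HopfIdeal

variable {d : ℕ} (J : HopfIdeal d)

theorem space_orthogonal_eq : (J.space)ᗮ = (J.carrier.map (ContinuousLinearMap.apply ℂ (Fock d)
    (ket (1 : Word d)) : (Fock d →L[ℂ] Fock d) →ₗ[ℂ] Fock d)).topologicalClosure := by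
  rw [space, Submodule.orthogonal_orthogonal_eq_closure]

/-- The orthogonal complement of `N_J` is invariant under `𝓛_d`. -/
theorem apply_mem_orthogonal {A : Fock d →L[ℂ] Fock d} (hA : A ∈ toeplitz d) {f : Fock d}
    (hf : f ∈ (J.space)ᗮ) : A f ∈ (J.space)ᗮ := by
  rw [space_orthogonal_eq] at hf
  refine Submodule.topologicalClosure_minimal (t := (J.space)ᗮ.comap (A : Fock d →ₗ[ℂ] Fock d)) _
    ?_ ((Submodule.isClosed_orthogonal _).preimage A.continuous) hf
  rintro _ ⟨B, hB, rfl⟩ x hx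
  exact J.inner_space hx (J.mul_mem_left A hA B hB) (ket 1)

/-- The homogeneous components of an element of the kernel of `π_J` belong to `J`. -/
theorem homogeneousPart_mem_of_proj_eq_zero (hJ : J.IsHomogeneous) {A : Fock d →L[ℂ] Fock d}
    (hA : A ∈ toeplitz d) (h : J.proj A = 0) (n : ℕ) : homogeneousPart d n A ∈ J.carrier := by
  have h1 : A (ket 1) ∈ (J.space)ᗮ := by
    -- The vector `ξ_∅` need not lie in `N_J` (it does not if `1 ∈ J`), so it is split along `N_J`.
    -- `A` maps the part in `N_J` to the complement because `π_J(A) = 0`, and the other part because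
    -- the complement is invariant.
    have hp : A (J.space.orthogonalProjectionOnto (ket 1)) ∈ (J.space)ᗮ := by
      rw [Submodule.mem_orthogonal]
      intro y hy
      have := inner_compress J.space A (J.space.orthogonalProjectionOnto (ket 1)) ⟨y, hy⟩
      rw [← this]
      change ⟪_, J.proj A _⟫_ℂ = 0
      simp [h]
    have hq := J.apply_mem_orthogonal hA
      (J.space.sub_starProjection_mem_orthogonal (ket 1))
    rw [map_sub] at hq
    exact (add_sub_cancel (A (J.space.starProjection (ket 1))) (A (ket 1))) ▸ add_mem hp hq
  rw [space_orthogonal_eq] at h1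
  -- The preimage of the norm-closed space `J` under the continuous symbol map is closed, so it is
  -- enough to treat `B ξ_∅` with `B ∈ J`.
  refine Submodule.topologicalClosure_minimal
    (t := J.carrier.comap (homogeneousSymbol d n : Fock d →ₗ[ℂ] (Fock d →L[ℂ] Fock d))) _ ?_
    (J.isClosed_carrier.preimage (homogeneousSymbol d n).continuous) h1
  rintro _ ⟨B, hB, rfl⟩
  exact hJ.homogeneousPart_mem hB n

theorem leftRegular₀_coe (w : Word d) : leftRegular₀ d (w : WithZero (Word d)) = leftShift w := rfl

/-- Distinct elements of the semigroup associated with `J` give distinct operators. -/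
theorem repr_injective (hJ : J.IsHomogeneous) : Function.Injective J.repr := by
  intro s t
  induction s, t using Con.induction_on₂ with
  | _ u v =>
  intro h
  refine (Con.eq J.con).2 ?_
  change leftRegular₀ d u - leftRegular₀ d v ∈ J.carrier
  have h0 : J.proj (leftRegular₀ d u - leftRegular₀ d v) = 0 := by
    rw [map_sub, sub_eq_zero]
    exact congrArg Subtype.val h
  -- That the kernel of `π_J` equals `J` is not needed: the finitely many components of a difference
  -- of two words determine it.
  have key := J.homogeneousPart_mem_of_proj_eq_zero hJ
    (sub_mem (leftRegular₀_mem u) (leftRegular₀_mem v)) h0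
  simp only [map_sub] at key
  induction u using WithZero.recZeroCoe with
  | zero =>
    induction v using WithZero.recZeroCoe with
    | zero => simp
    | coe v =>
      have := key v.length
      rwa [map_zero, leftRegular₀_coe, homogeneousPart_leftShift, if_pos rfl, map_zero] at this
  | coe u =>
    induction v using WithZero.recZeroCoe with
    | zero =>
      have := key u.length
      rwa [map_zero, leftRegular₀_coe, homogeneousPart_leftShift, if_pos rfl, map_zero] at this
    | coe v =>
      have h1 := key u.length
      have h2 := key v.length
      simp only [leftRegular₀_coe, homogeneousPart_leftShift, if_true] at h1 h2 ⊢
      -- For equal lengths the difference is homogeneous, hence its own component. For different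
      -- lengths `L_u` and `-L_v` are separate components, so both lie in `J` and so does their sum.
      by_cases huv : v.length = u.length
      · rwa [if_pos huv] at h1
      · rw [if_neg huv, sub_zero] at h1
        rw [if_neg (Ne.symm huv), zero_sub] at h2
        simpa [sub_eq_add_neg] using J.carrier.add_mem h1 h2

/-! ### Truncation of vectors and the grading of `N_J`. -/

/-- The words of length less than `n`. -/
def wordsBelow (d n : ℕ) : Finset (Word d) := (List.finite_length_lt (Fin d) n).toFinset

@[simp]
theorem mem_wordsBelow {n : ℕ} {w : Word d} : w ∈ wordsBelow d n ↔ w.length < n :=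
  Set.Finite.mem_toFinset _

/-- The truncation of a vector to the words of length less than `n`. -/
def truncate (n : ℕ) (f : Fock d) : Fock d := ∑ w ∈ wordsBelow d n, f w • ket w

theorem truncate_mem_span (n : ℕ) (f : Fock d) :
    truncate n f ∈ Submodule.span ℂ (ket '' {w : Word d | w.length < n}) :=
  Submodule.sum_mem _ fun w hw => Submodule.smul_mem _ _
    (Submodule.subset_span ⟨w, mem_wordsBelow.1 hw, rfl⟩)

/-- The sets of words of length less than `n` increase and exhaust all words, so they are cofinal in
the unconditional sum over the basis. -/
theorem tendsto_truncate (f : Fock d) :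
    Filter.Tendsto (fun n => truncate n f) Filter.atTop (nhds f) :=
  (hasSum_ket f).comp (Filter.tendsto_atTop_finset_of_monotone
    (fun _ _ hmn _ hw => mem_wordsBelow.2 ((mem_wordsBelow.1 hw).trans_le hmn))
    fun w => ⟨w.length + 1, mem_wordsBelow.2 (Nat.lt_succ_self _)⟩)

/-- Applying the degree-`k` symbol of `f` to `ξ_∅` projects `f` onto degree `k`; this ties
truncation to homogeneous components. -/
theorem truncate_eq_sum (n : ℕ) (f : Fock d) :
    truncate n f = ∑ k ∈ Finset.range n, homogeneousSymbol d k f (ket 1) := by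
  classical
  have h : wordsBelow d n = (Finset.range n).biUnion (wordsOfLength d) := by
    ext w
    simp
  rw [truncate, h, Finset.sum_biUnion]
  · simp [homogeneousSymbol_apply, leftShift_ket]
  · intro i _ j _ hij
    rw [Function.onFun, Finset.disjoint_left]
    intro w hw hw'
    exact hij ((mem_wordsOfLength.1 hw).symm.trans (mem_wordsOfLength.1 hw'))

/-- The space `N_J` of a homogeneous ideal is graded. -/
theorem truncate_mem_space (hJ : J.IsHomogeneous) (n : ℕ) {f : Fock d} (hf : f ∈ J.space) :
    truncate n f ∈ J.space := by
  rw [truncate_eq_sum]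
  refine Submodule.sum_mem _ fun k _ => J.mem_space_iff.2 fun A hA => ?_
  -- The projection onto degree `k` is self-adjoint: pairing the degree-`k` part of `f` with `A ξ_∅`
  -- amounts to pairing `f` with the degree-`k` component of `A` applied to `ξ_∅`, and that
  -- component is in `J`.
  have h := J.inner_space hf (hJ.homogeneousPart_mem hA k) (ket 1)
  rw [homogeneousPart_eq, homogeneousSymbol_apply] at h
  rw [homogeneousSymbol_apply, ← h]
  simp only [sum_apply, smul_apply, leftShift_ket, mul_one,
    sum_inner, inner_sum, inner_smul_left, inner_smul_right, inner_ket]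
  refine Finset.sum_congr rfl fun w _ => ?_
  rw [← inner_conj_symm f, inner_ket, mul_comm]

end HopfIdeal

/-! ### Slices along finitely supported vectors. -/

/-- The slices of an element of `𝓛_d` along vectors supported on short words are polynomials. -/
theorem sliceMap_mem_span {d n : ℕ} {T : Fock d →L[ℂ] Fock d} (hT : T ∈ toeplitz d) {x y : Fock d}
    (hx : x ∈ Submodule.span ℂ (ket '' {w : Word d | w.length < n}))
    (hy : y ∈ Submodule.span ℂ (ket '' {w : Word d | w.length < n})) :
    sliceMap x y T ∈ Submodule.span ℂ (leftShift '' {w : Word d | w.length < n}) := by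
  set V := Submodule.span ℂ (leftShift '' {w : Word d | w.length < n}) with hV
  have h1 : ∀ (b : Word d), b.length < n → sliceMap x (ket b) T ∈ V := by
    intro b hb
    obtain ⟨g, hg⟩ := sliceMap_clm_left (ket b) T
    rw [← hg]
    refine (Submodule.span_le (p := V.comap (g : Fock d →ₗ[ℂ] (Fock d →L[ℂ] Fock d)))).2 ?_ hx
    rintro _ ⟨a, -, rfl⟩
    change g (ket a) ∈ V
    rw [hg]
    -- The slice along `ξ_a` and `ξ_b` sees only the coefficient of the word `w` with `b = w * a`,
    -- if there is one; its length is bounded by that of `b`.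
    by_cases h : ∃ w, b = w * a
    · obtain ⟨w, rfl⟩ := h
      rw [sliceMap_ket hT]
      rw [FreeMonoid.length_mul] at hb
      exact V.smul_mem _ (Submodule.subset_span ⟨w, by simp only [Set.mem_ofPred_eq]; omega, rfl⟩)
    · rw [sliceMap_ket_zero hT a b h]
      exact V.zero_mem
  obtain ⟨g, hg⟩ := sliceMap_clm_right x T
  rw [← hg]
  refine (Submodule.span_le
    (p := V.comap (g : Fock d →ₛₗ[starRingEnd ℂ] (Fock d →L[ℂ] Fock d)))).2 ?_ hy
  rintro _ ⟨b, hb, rfl⟩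
  change g (ket b) ∈ V
  rw [hg]
  exact h1 b hb

/-! ### Vector functionals in the predual and convolution with them. -/

namespace HopfIdeal

variable {d : ℕ} (J : HopfIdeal d)

/-- The functional `T ↦ ⟨T x, y⟩` on `𝓛_J`. -/
def vectorFunctional (y x : J.space) : J.algebra →ₗ[ℂ] ℂ where
  toFun T := ⟪y, (T : J.space →L[ℂ] J.space) x⟫_ℂ
  map_add' S T := by simp
  map_smul' c T := by simp

theorem isTraceRep_vectorFunctional (y x : J.space) :
    IsTraceRep (J.vectorFunctional y x) (Pi.single 0 x) (Pi.single 0 y) := by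
  have hs : ∀ n ∉ ({0} : Finset ℕ), ‖(Pi.single 0 x : ℕ → J.space) n‖ *
      ‖(Pi.single 0 y : ℕ → J.space) n‖ = 0 := by
    intro n hn
    rw [Pi.single_eq_of_ne (by simpa using hn), norm_zero, zero_mul]
  refine ⟨summable_of_ne_finset_zero hs, fun T => ?_⟩
  rw [tsum_eq_single 0]
  · simp [vectorFunctional]
  · intro n hn
    rw [Pi.single_eq_of_ne hn, inner_zero_left]

/-- The functional `ω_{x,y} : T ↦ ⟨T x, y⟩` as an element of the predual of `𝓛_J`. -/
def omega (y x : J.space) : J.Predual :=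
  ⟨J.vectorFunctional y x, _, _, J.isTraceRep_vectorFunctional y x⟩

theorem omega_apply (y x : J.space) (T : J.algebra) :
    J.omega y x T = ⟪y, (T : J.space →L[ℂ] J.space) x⟫_ℂ := rfl

theorem isTraceRep_omega (y x : J.space) :
    IsTraceRep (J.omega y x).1 (Pi.single 0 x) (Pi.single 0 y) :=
  J.isTraceRep_vectorFunctional y x

theorem norm_omega_le (y x : J.space) : ‖J.omega y x‖ ≤ ‖x‖ * ‖y‖ := by
  refine (Predual.norm_le (ι := Unit) (x := fun _ => x) (y := fun _ => y) (J.omega y x)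
    Summable.of_finite (fun T => ?_)).trans ?_
  · rw [tsum_fintype, Fintype.sum_unique]
    rfl
  · rw [tsum_fintype, Fintype.sum_unique]

/-- The telescoping identity that turns separate bounds into joint continuity of `ω` in
`tendsto_omega`. -/
theorem omega_sub_omega (y x y' x' : J.space) :
    J.omega y x - J.omega y' x' = J.omega (y - y') x + J.omega y' (x - x') := by
  refine DFunLike.ext _ _ fun T => ?_
  change J.omega y x T - J.omega y' x' T = J.omega (y - y') x T + J.omega y' (x - x') T
  simp only [omega_apply, map_sub, inner_sub_left, inner_sub_right]
  ring

theorem tendsto_omega {y x : J.space} {u v : ℕ → J.space}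
    (hu : Filter.Tendsto u Filter.atTop (nhds y)) (hv : Filter.Tendsto v Filter.atTop (nhds x)) :
    Filter.Tendsto (fun n => J.omega (u n) (v n)) Filter.atTop (nhds (J.omega y x)) := by
  rw [tendsto_iff_norm_sub_tendsto_zero]
  refine squeeze_zero (g := fun n => ‖v n‖ * ‖u n - y‖ + ‖v n - x‖ * ‖y‖)
    (fun n => norm_nonneg _) (fun n => ?_) ?_
  · rw [omega_sub_omega]
    exact (norm_add_le _ _).trans (add_le_add (J.norm_omega_le _ _) (J.norm_omega_le _ _))
  · have h1 := hv.norm.mul (tendsto_iff_norm_sub_tendsto_zero.1 hu)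
    have h2 := (tendsto_iff_norm_sub_tendsto_zero.1 hv).mul_const ‖y‖
    simpa using h1.add h2

/-- Evaluation at an element of `𝓛_J` as a continuous functional on the predual. -/
def eval (T : J.algebra) : J.Predual →L[ℂ] ℂ :=
  LinearMap.mkContinuous
    { toFun := fun φ => φ T
      map_add' := fun _ _ => rfl
      map_smul' := fun _ _ => rfl }
    ‖(T : J.space →L[ℂ] J.space)‖ fun φ => by
      rw [mul_comm]
      exact Predual.norm_apply_le φ T

/-- The bound on `‖ω_{x,y}‖` makes the nuclear series absolutely convergent in the complete predual,
and evaluations identify its limit. Thus a continuous functional on the predual is determined by its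
values on the `ω_{x,y}`. -/
theorem hasSum_omega {φ : J.Predual} {x y : ℕ → J.space} (h : IsTraceRep φ.1 x y) :
    HasSum (fun n => J.omega (y n) (x n)) φ := by
  have hs : Summable fun n => J.omega (y n) (x n) := by
    exact Summable.of_norm_bounded h.1 fun n => J.norm_omega_le _ _
  have he : ∑' n, J.omega (y n) (x n) = φ := by
    refine DFunLike.ext _ _ fun T => ?_
    have h1 := (hs.hasSum.mapL (J.eval T)).tsum_eq
    exact h1.symm.trans (h.2 T).symm
  exact he ▸ hs.hasSum

/-- A nonzero continuous functional on the predual does not vanish on some `ω_{x,y}` with `x` and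
`y` supported on finitely many words. -/
theorem exists_omega_ne_zero (hJ : J.IsHomogeneous) {ρ : J.Predual →L[ℂ] ℂ} (hρ : ρ ≠ 0) :
    ∃ (n : ℕ) (x y : J.space),
      (x : Fock d) ∈ Submodule.span ℂ (ket '' {w : Word d | w.length < n}) ∧
      (y : Fock d) ∈ Submodule.span ℂ (ket '' {w : Word d | w.length < n}) ∧
      ρ (J.omega y x) ≠ 0 := by
  by_contra! hc
  refine hρ (ContinuousLinearMap.ext fun φ => ?_)
  -- Truncations stay in `N_J` because that space is graded, so vanishing on finitely supported
  -- pairs passes to all pairs by continuity of `ω`, and then to all sums of such functionals.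
  have ht : ∀ z : J.space, Filter.Tendsto
      (fun n => (⟨truncate n z, J.truncate_mem_space hJ n z.2⟩ : J.space)) Filter.atTop (nhds z) :=
    fun z => tendsto_subtype_rng.2 (tendsto_truncate (z : Fock d))
  have h0 : ∀ x y : J.space, ρ (J.omega y x) = 0 := by
    intro x y
    refine tendsto_nhds_unique ((ρ.continuous.tendsto _).comp (J.tendsto_omega (ht y) (ht x))) ?_
    refine tendsto_const_nhds.congr fun n => ?_
    exact (hc n _ _ (truncate_mem_span n _) (truncate_mem_span n _)).symm
  obtain ⟨x, y, h⟩ := J.exists_rep φ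
  have := (J.hasSum_omega h).mapL ρ
  simp only [h0] at this
  exact this.unique hasSum_zero

theorem algebra_ext {S T : J.algebra} (h : ∀ φ : J.Predual, φ S = φ T) : S = T :=
  Subtype.ext (ContinuousLinearMap.ext fun x => ext_inner_left ℂ fun y => h (J.omega y x))

theorem sliceMapJ_zero (B : J.algebra) : J.sliceMapJ 0 0 B = 0 := by
  refine Subtype.ext (ContinuousLinearMap.ext fun z => ext_inner_left ℂ fun z' => ?_)
  have h : J.tmulJ 0 z = 0 := Subtype.ext (by simp [tmulJ])
  rw [inner_sliceMapJ, h]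
  simp

/-- In the one-term representation of `ω_{x,y}` only the index `0` contributes, so the convolution
is `ψ` composed with a single slice map. -/
theorem omega_mul_apply (y x : J.space) (ψ : J.Predual) (B : J.algebra) :
    (J.omega y x * ψ) B = ψ (J.sliceMapJ x y B) := by
  rw [J.mul_apply_left (J.isTraceRep_omega y x), tsum_eq_single 0]
  · simp
  · intro n hn
    rw [Pi.single_eq_of_ne hn, Pi.single_eq_of_ne hn, sliceMapJ_zero]
    exact ψ.1.map_zero

/-- The operator `L_w ∈ 𝓛_J`, for a word `w`. -/
def wordOp (w : Word d) : J.algebra := J.repr ((w : WithZero (Word d)) : J.con.Quotient)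

/-- The slice of any `B` along `x` and `y` is a combination of the `L_w` with `|w| < n`, so the
product sees only finitely many values of `ψ`. This finiteness makes the search for characters a
finite problem. -/
theorem omega_mul_eq_zero {n : ℕ} {x y : J.space}
    (hx : (x : Fock d) ∈ Submodule.span ℂ (ket '' {w : Word d | w.length < n}))
    (hy : (y : Fock d) ∈ Submodule.span ℂ (ket '' {w : Word d | w.length < n}))
    {ψ : J.Predual} (hψ : ∀ w : Word d, w.length < n → ψ (J.wordOp w) = 0) :
    J.omega y x * ψ = 0 := by
  refine DFunLike.ext _ _ fun B => ?_
  obtain ⟨_, A, hA, rfl⟩ := B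
  rw [omega_mul_apply, J.sliceMapJ_proj x y A hA]
  -- Keeps every stage of the span induction inside `𝓛_d`, so that `ψ` can be applied to its
  -- compression.
  have hle : Submodule.span ℂ (leftShift '' {w : Word d | w.length < n}) ≤
      Subalgebra.toSubmodule (toeplitz d) :=
    Submodule.span_le.2 (by rintro _ ⟨w, -, rfl⟩; exact leftShift_mem w)
  change ψ.1 _ = 0
  refine Submodule.span_induction (p := fun C hC => ψ.1 ⟨J.proj C, C, hle hC, rfl⟩ = 0)
    ?_ ?_ ?_ ?_ (sliceMap_mem_span hA hx hy)
  · rintro _ ⟨w, hw, rfl⟩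
    exact hψ w hw
  · exact (congrArg ψ.1 (Subtype.ext (map_zero J.proj))).trans ψ.1.map_zero
  · intro C D hC hD h h'
    have : (⟨J.proj (C + D), C + D, hle (add_mem hC hD), rfl⟩ : J.algebra) =
        ⟨J.proj C, C, hle hC, rfl⟩ + ⟨J.proj D, D, hle hD, rfl⟩ := Subtype.ext (map_add J.proj C D)
    rw [this, map_add, h, h', add_zero]
  · intro c C hC h
    have : (⟨J.proj (c • C), c • C, hle (Submodule.smul_mem _ c hC), rfl⟩ : J.algebra) =
        c • ⟨J.proj C, C, hle hC, rfl⟩ := Subtype.ext (map_smul J.proj c C)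
    rw [this, map_smul, h, smul_zero]

/-! ### Semigroup-like elements and multiplicative evaluations. -/

theorem inner_tensorJ (B C : J.space →L[ℂ] J.space) (x x' y y' : J.space) :
    ⟪J.tmulJ y y', J.tensorJ B C (J.tmulJ x x')⟫_ℂ = ⟪y, B x⟫_ℂ * ⟪y', C x'⟫_ℂ := by
  rw [tensorJ, inner_compress]
  change ⟪tmul (y : Fock d) (y' : Fock d), tensorOp _ _ (tmul (x : Fock d) (x' : Fock d))⟫_ℂ = _
  rw [tensorOp_tmul, inner_tmul, inner_extendByZero J.space B x.2 y.2,
    inner_extendByZero J.space C x'.2 y'.2]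

/-- Operators on `N_J ⊗ N_J` with the same matrix coefficients at elementary tensors agree. -/
theorem space2_op_ext {S T : J.space2 →L[ℂ] J.space2} (h : ∀ x x' y y' : J.space,
    ⟪J.tmulJ y y', S (J.tmulJ x x')⟫_ℂ = ⟪J.tmulJ y y', T (J.tmulJ x x')⟫_ℂ) : S = T := by
  rw [← sub_eq_zero]
  have h1 : ∀ x x' : J.space, (S - T) (J.tmulJ x x') = 0 := by
    intro x x'
    -- The vector `(S - T)(x ⊗ x')` is orthogonal to all elementary tensors, hence to all of `N_J ⊗
    -- N_J`, to which it belongs itself; so it is zero.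
    have hz := J.space2_induction
      (V := (ℂ ∙ (((S - T) (J.tmulJ x x') : J.space2) : Fock2 d))ᗮ)
      (Submodule.isClosed_orthogonal _) (fun y hy y' hy' => by
        rw [Submodule.mem_orthogonal_singleton_iff_inner_left]
        have := h x x' ⟨y, hy⟩ ⟨y', hy'⟩
        rw [← sub_eq_zero, ← inner_sub_right] at this
        exact this) ((S - T) (J.tmulJ x x')).2
    rw [Submodule.mem_orthogonal_singleton_iff_inner_left, inner_self_eq_zero] at hz
    exact Subtype.ext hz
  ext1 z
  -- Composing with the projection gives an operator on the ambient space, whose kernel is a closed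
  -- subspace containing the elementary tensors.
  have hz := J.space2_induction
    (V := LinearMap.ker (((S - T) ∘L J.space2.orthogonalProjectionOnto : Fock2 d →L[ℂ] J.space2) :
      Fock2 d →ₗ[ℂ] J.space2))
    (ContinuousLinearMap.isClosed_ker ((S - T) ∘L J.space2.orthogonalProjectionOnto))
    (fun x hx y hy => by
      have h2 := h1 ⟨x, hx⟩ ⟨y, hy⟩
      have h3 : J.space2.orthogonalProjectionOnto (tmul x y) = J.tmulJ ⟨x, hx⟩ ⟨y, hy⟩ :=
        J.space2.orthogonalProjectionOnto_mem_subspace_eq_self (J.tmulJ ⟨x, hx⟩ ⟨y, hy⟩)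
      rw [LinearMap.mem_ker]
      change (S - T) (J.space2.orthogonalProjectionOnto (tmul x y)) = 0
      rw [h3, h2]) z.2
  rw [LinearMap.mem_ker] at hz
  change (S - T) (J.space2.orthogonalProjectionOnto z) = 0 at hz
  rwa [J.space2.orthogonalProjectionOnto_mem_subspace_eq_self z] at hz

/-- The elements `L_s` are semigroup-like. -/
theorem comulJ_repr (s : J.semigroup) :
    J.comulJ (J.repr s) = J.tensorJ (J.repr s) (J.repr s) := by
  induction s using Con.induction_on with
  | _ w =>
  change J.comulJ (J.proj (leftRegular₀ d w)) =
    J.tensorJ (J.proj (leftRegular₀ d w)) (J.proj (leftRegular₀ d w))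
  -- The identity holds already before compression; the zero element is separate because `L_0 = 0`
  -- is not a shift.
  have hΔ : comul (leftRegular₀ d w) = tensorOp (leftRegular₀ d w) (leftRegular₀ d w) := by
    induction w using WithZero.recZeroCoe with
    | zero =>
      rw [map_zero]
      have h0 : comul (0 : Fock d →L[ℂ] Fock d) = 0 := by
        simpa using comul_smul 0 (0 : Fock d →L[ℂ] Fock d)
      rw [h0]
      refine clm_ext_ket fun ⟨u, v⟩ => ?_
      rw [ket_prod, tensorOp_tmul]
      simp
    | coe w => exact comul_leftShift w
  refine J.space2_op_ext fun x x' y y' => ?_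
  rw [comulJ_proj, inner_compress, inner_tensorJ, hΔ, proj, inner_compress, inner_compress]
  change ⟪tmul (y : Fock d) (y' : Fock d), tensorOp _ _ (tmul (x : Fock d) (x' : Fock d))⟫_ℂ = _
  rw [tensorOp_tmul, inner_tmul]

/-- Evaluation at a semigroup-like element is multiplicative. -/
theorem mul_apply_of_comulJ_eq {F : J.algebra} (hF : J.comulJ F = J.tensorJ F F)
    (φ ψ : J.Predual) : (φ * ψ) F = φ F * ψ F := by
  obtain ⟨x, y, h⟩ := J.exists_rep φ
  obtain ⟨x', y', h'⟩ := J.exists_rep ψ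
  have e1 : φ F = ∑' n, ⟪y n, (F : J.space →L[ℂ] J.space) (x n)⟫_ℂ := h.2 F
  have e2 : ψ F = ∑' n, ⟪y' n, (F : J.space →L[ℂ] J.space) (x' n)⟫_ℂ := h'.2 F
  rw [J.mul_apply_rep h h', e1, e2]
  have hs := J.summable_inner_tmulJ h.1 h'.1 (F : J.space →L[ℂ] J.space)
  simp only [hF, inner_tensorJ] at hs ⊢
  -- At a semigroup-like `F` each term of the double series factors, leaving a product of two
  -- absolutely convergent series.
  exact ((summable_inner_apply h.1 _).tsum_mul_tsum (summable_inner_apply h'.1 _) hs).symm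

theorem repr_zero : J.repr 0 = 0 := Subtype.ext (by
  change J.proj (leftRegular₀ d 0) = 0
  rw [map_zero, map_zero])

/-! ### The characters of the predual. -/

/-- Every nonzero multiplicative continuous functional on the predual is the evaluation at some
`L_s` with `s ≠ 0`. -/
theorem exists_eq_eval (hJ : J.IsHomogeneous) {ρ : J.Predual →L[ℂ] ℂ} (hρ : ρ ≠ 0)
    (hmul : ∀ φ ψ, ρ (φ * ψ) = ρ φ * ρ ψ) :
    ∃ s : J.semigroup, s ≠ 0 ∧ ∀ φ, ρ φ = φ (J.repr s) := by
  obtain ⟨n, x, y, hx, hy, hxy⟩ := J.exists_omega_ne_zero hJ hρ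
  obtain ⟨w, hw⟩ : ∃ w : Word d, ∀ φ, ρ φ = φ (J.wordOp w) := by
    by_contra! hc
    -- For each word `w` in `W`, the element is multiplied by a factor `ψ - ψ(L_w)`, formed in the
    -- unitization since no unit is assumed. The factor kills evaluation at `L_w`, and `ρ` scales by
    -- `ρ(ψ) - ψ(L_w) ≠ 0`.
    have key : ∀ W : Finset (Word d), ∃ χ, ρ χ ≠ 0 ∧ ∀ w ∈ W, χ (J.wordOp w) = 0 := by
      intro W
      classical
      induction W using Finset.induction_on with
      | empty => exact ⟨_, hxy, by simp⟩
      | insert w W _ ih =>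
        obtain ⟨χ, hχ, h0⟩ := ih
        obtain ⟨ψ, hψ⟩ := hc w
        -- Evaluation at any `L_v` is multiplicative, so the new factor merely rescales the old
        -- value and earlier zeros persist.
        have hev : ∀ v, (ψ * χ - ψ (J.wordOp w) • χ) (J.wordOp v) =
            (ψ (J.wordOp v) - ψ (J.wordOp w)) * χ (J.wordOp v) := by
          intro v
          have h1 := J.mul_apply_of_comulJ_eq (F := J.wordOp v) (J.comulJ_repr _) ψ χ
          rw [sub_mul, ← h1]
          exact map_sub (J.eval (J.wordOp v)) _ _
        refine ⟨ψ * χ - ψ (J.wordOp w) • χ, ?_, fun v hv => ?_⟩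
        · rw [map_sub, map_smul, hmul, smul_eq_mul, ← sub_mul]
          exact mul_ne_zero (sub_ne_zero.2 hψ) hχ
        · rw [hev]
          rcases Finset.mem_insert.1 hv with rfl | hv
          · rw [sub_self, zero_mul]
          · rw [h0 v hv, mul_zero]
    -- Killing the words of length less than `n` suffices for `ω_{x,y} ⋆ χ = 0`, although `ρ` is
    -- nonzero on both factors.
    obtain ⟨χ, hχ, h0⟩ := key (wordsBelow d n)
    have := hmul (J.omega y x) χ
    rw [J.omega_mul_eq_zero hx hy fun w hw => h0 w (mem_wordsBelow.2 hw), map_zero] at this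
    exact mul_ne_zero hxy hχ this.symm
  -- The word `w` may represent the zero class a priori; then `L_w` would be `0` and `ρ` would
  -- vanish.
  refine ⟨((w : WithZero (Word d)) : J.con.Quotient), fun h => hρ ?_, hw⟩
  refine ContinuousLinearMap.ext fun φ => ?_
  rw [hw, wordOp, h, repr_zero]
  exact φ.1.map_zero

theorem eval_ne_zero {F : J.algebra} (hF : F ≠ 0) : J.eval F ≠ 0 := fun h =>
  hF (J.algebra_ext fun φ => (DFunLike.congr_fun h φ).trans φ.1.map_zero.symm)

theorem repr_ne_zero (hJ : J.IsHomogeneous) {s : J.semigroup} (hs : s ≠ 0) : J.repr s ≠ 0 :=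
  fun h => hs (J.repr_injective hJ (h.trans J.repr_zero.symm))

/-- The character `ρ_s : φ ↦ φ(L_s)` of the predual. -/
def character (hJ : J.IsHomogeneous) (s : {s : J.semigroup // s ≠ 0}) :
    WeakDual.characterSpace ℂ J.Predual :=
  ⟨StrongDual.toWeakDual (J.eval (J.repr s)),
    fun h => J.eval_ne_zero (J.repr_ne_zero hJ s.2) (StrongDual.toWeakDual.injective h),
    fun φ ψ => J.mul_apply_of_comulJ_eq (J.comulJ_repr s) φ ψ⟩

theorem character_apply (hJ : J.IsHomogeneous) (s : {s : J.semigroup // s ≠ 0}) (φ : J.Predual) :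
    J.character hJ s φ = φ (J.repr s) := rfl

/-- The predual separates the points of `𝓛_J`, so equal characters come from equal operators and
`repr_injective` applies; surjectivity is `exists_eq_eval`. -/
theorem character_bijective (hJ : J.IsHomogeneous) : Function.Bijective (J.character hJ) := by
  constructor
  · intro s t h
    refine Subtype.ext (J.repr_injective hJ (J.algebra_ext fun φ => ?_))
    rw [← J.character_apply hJ, ← J.character_apply hJ, h]
  · intro ρ
    obtain ⟨s, hs, h⟩ := J.exists_eq_eval hJ (ρ := WeakDual.toStrongDual ρ.1)
      (fun h => ρ.2.1 (WeakDual.toStrongDual.injective h)) ρ.2.2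
    refine ⟨⟨s, hs⟩, ?_⟩
    ext φ
    exact (h φ).symm

/-- The semigroup-like elements of `𝓛_J` are the `L_s`. -/
theorem comulJ_eq_tensorJ_iff (hJ : J.IsHomogeneous) (F : J.algebra) :
    J.comulJ F = J.tensorJ F F ↔ ∃! s : J.semigroup, F = J.repr s := by
  constructor
  · intro hF
    obtain ⟨s, hs⟩ : ∃ s : J.semigroup, F = J.repr s := by
      -- The zero operator is semigroup-like but evaluates to the zero functional, which is not a
      -- character; it is accounted for by `L_0`.
      by_cases h0 : F = 0
      · exact ⟨0, h0.trans J.repr_zero.symm⟩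
      · obtain ⟨s, -, hs⟩ := J.exists_eq_eval hJ (J.eval_ne_zero h0) (J.mul_apply_of_comulJ_eq hF)
        exact ⟨s, J.algebra_ext hs⟩
    exact ⟨s, hs, fun t ht => J.repr_injective hJ (ht.symm.trans hs)⟩
  · rintro ⟨s, rfl, -⟩
    exact J.comulJ_repr s

end HopfIdeal

end NCToeplitz

end

theorem theorem5p2 (d : ℕ) (J : NCToeplitz.HopfIdeal d) (hJ : J.IsHomogeneous) :
    (∃ e : {s : J.semigroup // s ≠ 0} ≃ WeakDual.characterSpace ℂ J.Predual,
      ∀ (s : {s : J.semigroup // s ≠ 0}) (φ : J.Predual), e s φ = φ (J.repr s)) ∧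
    ∀ F : J.algebra, J.comulJ F = J.tensorJ F F ↔ ∃! s : J.semigroup, F = J.repr s :=
  ⟨⟨Equiv.ofBijective _ (J.character_bijective hJ), J.character_apply hJ⟩,
    J.comulJ_eq_tensorJ_iff hJ⟩
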